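/- Let $\alpha>1/2$ and $C\in\mathbb{R}$. For $n\in\mathbb{N}$ put $R=R(n)=2\log n+C$ and let $G_{\alpha,C}(n)$ be the random graph (random hyperbolic graph) with vertex set $\{1,\dots,n\}$ defined as follows. The vertices $v$ receive independent random polar coordinates $(r_v,\theta_v)$, where $r_v\in[0,R]$ has density $r\mapsto \alpha\sinh(\alpha r)/(\cosh(\alpha R)-1)$ and $\theta_v$ is uniform on $[-\pi,\pi]$ and independent of $r_v$; two distinct vertices $u,v$ are adjacent if and only if $d(r_u,r_v,\theta_u-\theta_v)\le R$, where the hyperbolic distance $d=d(r,r',\varphi)\ge 0$ is the solution of $\cosh d=\cosh r\cosh r'-\sinh r\sinh r'\cos\varphi$. (This is defined when $R(n)>0$, hence for all sufficiently large $n$.) For a graph $G=(V,E)$ with $n$ vertices let $$\bar c(G)=\frac1n\sum_{v\in V}\bar c_v,\qquad \bar c_v=\begin{cases}0&\text{if }\deg(v)<2,\\ \dfrac{|\{\{u_1,u_2\}\in E: u_1,u_2\in\Gamma(v)\}|}{\binom{\deg(v)}{2}}&\text{otherwise,}\end{cases}$$ be its global clustering coefficient, where $\Gamma(v)$ is the set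 of neighbours of $v$. Let $\bar c=\bar c(G_{\alpha,C}(n))$. Then, as $n\to\infty$: 1. $\mathbb{E}[\bar c]=\Theta(1)$; 2. with high probability $\bar c=(1+o(1))\,\mathbb{E}[\bar c]$, that is, there is a sequence $\varepsilon_n\to0$ with $\Pr\bigl[\,|\bar c-\mathbb{E}[\bar c]|\le\varepsilon_n\mathbb{E}[\bar c]\,\bigr]\to1$; 3. in particular, there is a constant $c>0$ (depending only on $\alpha$ and $C$) such that $\Pr[\bar c\ge c]\to1$. -/

import Mathlib

open MeasureTheory Filter Asymptotics
open scoped Topology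

noncomputable section

namespace HyperbolicGraph

/-- Distance in the hyperbolic plane between the points with polar coordinates `(r, θ)` and
`(r', θ')`, where `φ = θ - θ'`: the nonnegative solution `d` of
`cosh d = cosh r * cosh r' - sinh r * sinh r' * cos φ`
(see `cosh_hypDist` and `hypDist_nonneg`). -/
def hypDist (r r' φ : ℝ) : ℝ :=
  Real.arcosh (Real.cosh r * Real.cosh r' - Real.sinh r * Real.sinh r' * Real.cos φ)

theorem one_le_cosh_law (r r' φ : ℝ) :
    1 ≤ Real.cosh r * Real.cosh r' - Real.sinh r * Real.sinh r' * Real.cos φ := by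
  have h1 := Real.one_le_cosh (r - r')
  have h2 := Real.one_le_cosh (r + r')
  rw [Real.cosh_sub] at h1
  rw [Real.cosh_add] at h2
  have h3 := Real.cos_le_one φ
  have h4 := Real.neg_one_le_cos φ
  rcases le_total 0 (Real.sinh r * Real.sinh r') with h | h <;> nlinarith

theorem cosh_hypDist (r r' φ : ℝ) :
    Real.cosh (hypDist r r' φ) =
      Real.cosh r * Real.cosh r' - Real.sinh r * Real.sinh r' * Real.cos φ :=
  Real.cosh_arcosh (one_le_cosh_law r r' φ)

theorem hypDist_nonneg (r r' φ : ℝ) : 0 ≤ hypDist r r' φ :=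
  Real.arcosh_nonneg (one_le_cosh_law r r' φ)

theorem hypDist_symm (r r' φ : ℝ) : hypDist r r' φ = hypDist r' r (-φ) := by
  simp only [hypDist, Real.cos_neg]
  congr 1
  ring

/-- The radius `R = 2 log n + C` of the disc. -/
def radius (C : ℝ) (n : ℕ) : ℝ := 2 * Real.log n + C

/-- Law of the radial coordinate: density `α sinh (α r) / (cosh (α R) - 1)` on `[0, R]`. -/
def radialMeasure (α R : ℝ) : Measure ℝ :=
  (volume.restrict (Set.Icc 0 R)).withDensity
    fun r => ENNReal.ofReal (α * Real.sinh (α * r) / (Real.cosh (α * R) - 1))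

/-- Law of the angular coordinate: the uniform distribution on `[-π, π]`. -/
def angularMeasure : Measure ℝ :=
  (volume.restrict (Set.Icc (-Real.pi) Real.pi)).withDensity
    fun _ => ENNReal.ofReal (1 / (2 * Real.pi))

/-- Joint law of the independent polar coordinates `(r_v, θ_v)`, `v ∈ {1, …, n}`, of the vertices;
the coordinates of a vertex are the pair `(r_v, θ_v)`. -/
def coordMeasure (α C : ℝ) (n : ℕ) : Measure (Fin n → ℝ × ℝ) :=
  Measure.pi fun _ => (radialMeasure α (radius C n)).prod angularMeasure

/-- The graph on `n` vertices with polar coordinates `x v = (r_v, θ_v)`, in which two distinct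
vertices are adjacent iff their hyperbolic distance is at most `R`. -/
def graph {n : ℕ} (R : ℝ) (x : Fin n → ℝ × ℝ) : SimpleGraph (Fin n) where
  Adj u v := u ≠ v ∧ hypDist (x u).1 (x v).1 ((x u).2 - (x v).2) ≤ R
  symm := ⟨by
    rintro u v ⟨huv, h⟩
    refine ⟨huv.symm, ?_⟩
    rwa [hypDist_symm, neg_sub] at h⟩
  loopless := ⟨fun _ h => h.1 rfl⟩

open Classical in
/-- Local clustering coefficient of a vertex: the fraction of the pairs of neighbors of `v` that
are themselves edges, and `0` if `v` has degree less than two. -/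
def localClustering {V : Type*} [Fintype V] (G : SimpleGraph V) (v : V) : ℝ :=
  if G.degree v < 2 then 0
  else ((G.edgeFinset.filter fun e => ∀ u ∈ e, G.Adj v u).card : ℝ) / ((G.degree v).choose 2 : ℝ)

/-- Global clustering coefficient: the average of the local clustering coefficients. -/
def globalClustering {V : Type*} [Fintype V] (G : SimpleGraph V) : ℝ :=
  (1 / (Fintype.card V : ℝ)) * ∑ v, localClustering G v

/-- The global clustering coefficient of the random hyperbolic graph with parameters `α`, `C` and
`n` vertices, as a function of the random coordinates, which have law `coordMeasure α C n`. -/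
def clustering (C : ℝ) (n : ℕ) (x : Fin n → ℝ × ℝ) : ℝ :=
  globalClustering (graph (radius C n) x)

/-- The expected global clustering coefficient of the random hyperbolic graph. -/
def expectedClustering (α C : ℝ) (n : ℕ) : ℝ :=
  ∫ x, clustering C n x ∂(coordMeasure α C n)

end HyperbolicGraph

end

/-!
The argument combines a variance bound with a lower bound for the mean. Write `R = 2 log n + C`, so
that `e ^ (-R / 2)` is a constant times `1 / n`.

*Variance.* Deleting the edges at a vertex `i` changes the local clustering coefficient of `i` and
of its neighbors only, hence changes `c̄` by at most `(1 + deg i) / n`, and the result does not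
depend on the coordinates of `i`. By the Efron–Stein inequality (`efron_stein`) the variance of `c̄`
is at most `n⁻² ∑ i, 𝔼[(1 + deg i) ^ 2]`. A vertex at radius `r` is adjacent to another one with
probability `O(e ^ (-r / 2))` (`coordLaw_nbhd_le`, where `α > 1 / 2` is used), so `deg i` is
binomial given `r` and its second moment is controlled by `n 𝔼[e ^ (-r / 2)]` and
`n² 𝔼[e ^ (-r)]`. For `1 / 2 < s < min 1 α` the latter is at most
`n² 𝔼[e ^ (-s r)] = O(n ^ (2 - 2 s))`, which is `o(n)`. Therefore the variance tends
to zero (`exists_variance_bound`), although degrees need not have bounded second moments.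

*Mean.* With probability bounded below a vertex `v` lies at distance at most one from the boundary
of the disc. Then each other vertex is adjacent to `v` with probability `O(1 / n)`, and with
probability at least a constant times `1 / n` it lies in a sector of the outermost annulus around
`v` in which all points are adjacent to each other. So with probability bounded below `v` has
exactly two neighbors and these are adjacent, whence its local clustering coefficient has
mean bounded below (`exists_le_expectedClustering`).

Chebyshev's inequality (`one_sub_le_measureReal_abs_sub_le`) then gives the concentration.
-/

noncomputable section

namespace HyperbolicGraph

/-! ### Clustering coefficients of finite graphs -/

section Combinatorics

variable {V : Type*} [Fintype V]

theorem localClustering_nonneg (G : SimpleGraph V) (v : V) : 0 ≤ localClustering G v := by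
  classical
  unfold localClustering
  split_ifs <;> positivity

theorem localClustering_le_one (G : SimpleGraph V) (v : V) : localClustering G v ≤ 1 := by
  classical
  unfold localClustering
  split_ifs with h
  · exact zero_le_one
  · refine div_le_one_of_le₀ ?_ (by positivity)
    rw [← G.card_neighborFinset_eq_degree v, ← Sym2.card_image_offDiag]
    norm_cast
    refine Finset.card_le_card fun e he => ?_
    induction e using Sym2.ind with
    | _ a b =>
      simp only [Finset.mem_filter, SimpleGraph.mem_edgeFinset, SimpleGraph.mem_edgeSet,
        Sym2.mem_iff, forall_eq_or_imp, forall_eq] at he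
      rw [Finset.mem_image]
      refine ⟨(a, b), ?_, rfl⟩
      simpa [Finset.mem_offDiag] using ⟨he.2.1, he.2.2, he.1.ne⟩

open Classical in
/-- The local clustering coefficient at `v` only depends on the neighbors of `v` and on the edges
between them. -/
theorem localClustering_congr {G H : SimpleGraph V} {v : V} (h₁ : ∀ u, G.Adj v u ↔ H.Adj v u)
    (h₂ : ∀ u w, G.Adj v u → G.Adj v w → (G.Adj u w ↔ H.Adj u w)) :
    localClustering G v = localClustering H v := by
  have hdeg : G.degree v = H.degree v := by
    rw [← G.card_neighborFinset_eq_degree, ← H.card_neighborFinset_eq_degree]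
    congr 1
    ext u
    simp [h₁]
  have hedge : (G.edgeFinset.filter fun e => ∀ u ∈ e, G.Adj v u) =
      H.edgeFinset.filter fun e => ∀ u ∈ e, H.Adj v u := by
    ext e
    induction e using Sym2.ind with
    | _ a b =>
      simp only [Finset.mem_filter, SimpleGraph.mem_edgeFinset, SimpleGraph.mem_edgeSet,
        Sym2.mem_iff, forall_eq_or_imp, forall_eq, ← h₁]
      exact and_congr_left fun hab => h₂ a b hab.1 hab.2
  unfold localClustering
  rw [hdeg, hedge]

open Classical in
theorem localClustering_eq_one {G : SimpleGraph V} {v a b : V} (hab : G.Adj a b)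
    (h : ∀ u, G.Adj v u ↔ u = a ∨ u = b) : localClustering G v = 1 := by
  have hdeg : G.degree v = 2 := by
    rw [← G.card_neighborFinset_eq_degree, ← Finset.card_pair hab.ne]
    congr 1
    ext u
    simp [h]
  refine le_antisymm (localClustering_le_one G v) ?_
  unfold localClustering
  rw [hdeg, if_neg (lt_irrefl 2)]
  have : (1 : ℝ) ≤ (G.edgeFinset.filter fun e => ∀ u ∈ e, G.Adj v u).card := by
    norm_cast
    refine Finset.card_pos.2 ⟨s(a, b), ?_⟩
    simp [h, hab]
  simpa using this

theorem globalClustering_le_one (G : SimpleGraph V) : globalClustering G ≤ 1 := by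
  unfold globalClustering
  rw [one_div_mul_eq_div]
  refine div_le_one_of_le₀ ?_ (by positivity)
  refine (Finset.sum_le_sum fun v _ => localClustering_le_one G v).trans (le_of_eq ?_)
  simp

open Classical in
/-- Deleting the edges at `i` affects the local clustering coefficients of `i` and of its
neighbors only. -/
theorem abs_globalClustering_sub_deleteIncidenceSet_le (G : SimpleGraph V) (i : V) :
    |globalClustering G - globalClustering (G.deleteIncidenceSet i)| ≤
      (1 / Fintype.card V) * (1 + (Finset.univ.filter fun j => G.Adj i j).card) := by
  unfold globalClustering
  rw [← mul_sub, ← Finset.sum_sub_distrib, abs_mul, abs_of_nonneg (by positivity)]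
  gcongr
  refine (Finset.abs_sum_le_sum_abs _ _).trans ?_
  have key : ∀ v, |localClustering G v - localClustering (G.deleteIncidenceSet i) v| ≤
      (if v = i then 1 else 0) + if G.Adj i v then 1 else 0 := by
    intro v
    have h1 : |localClustering G v - localClustering (G.deleteIncidenceSet i) v| ≤ 1 :=
      abs_sub_le_of_nonneg_of_le (localClustering_nonneg _ _) (localClustering_le_one _ _)
        (localClustering_nonneg _ _) (localClustering_le_one _ _)
    by_cases hv : v = i
    · subst hv
      simpa using h1
    by_cases hiv : G.Adj i v
    · simpa [hv, hiv] using h1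
    · have hvi : ∀ u, G.Adj v u → u ≠ i := by
        rintro u hu rfl
        exact hiv hu.symm
      rw [localClustering_congr (H := G.deleteIncidenceSet i)]
      · simp [hv, hiv]
      · intro u
        rw [SimpleGraph.deleteIncidenceSet_adj]
        exact ⟨fun h => ⟨h, hv, hvi u h⟩, fun h => h.1⟩
      · intro u w hu hw
        rw [SimpleGraph.deleteIncidenceSet_adj]
        exact ⟨fun h => ⟨h, hvi u hu, hvi w hw⟩, fun h => h.1⟩
  refine (Finset.sum_le_sum fun v _ => key v).trans (le_of_eq ?_)
  simp [Finset.sum_add_distrib]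

end Combinatorics

/-! ### The Efron–Stein inequality -/

section EfronStein

variable {X : Type*} [MeasurableSpace X] (μ : Measure X) [IsProbabilityMeasure μ]

/-- A bounded measurable real function. These are integrable against every finite measure and closed
under all operations used below. -/
def BddMeas {Y : Type*} [MeasurableSpace Y] (f : Y → ℝ) : Prop :=
  Measurable f ∧ ∃ M, ∀ y, |f y| ≤ M

namespace BddMeas

variable {Y Z : Type*} [MeasurableSpace Y] [MeasurableSpace Z] {f g : Y → ℝ}

theorem integrable (hf : BddMeas f) (ν : Measure Y) [IsFiniteMeasure ν] : Integrable f ν := by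
  obtain ⟨hm, M, hM⟩ := hf
  exact Integrable.of_bound hm.aestronglyMeasurable M (ae_of_all _ hM)

theorem sub (hf : BddMeas f) (hg : BddMeas g) : BddMeas fun y => f y - g y := by
  obtain ⟨hm, M, hM⟩ := hf
  obtain ⟨hm', M', hM'⟩ := hg
  exact ⟨hm.sub hm', M + M', fun y => (abs_sub _ _).trans (add_le_add (hM y) (hM' y))⟩

theorem add (hf : BddMeas f) (hg : BddMeas g) : BddMeas fun y => f y + g y := by
  obtain ⟨hm, M, hM⟩ := hf
  obtain ⟨hm', M', hM'⟩ := hg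
  exact ⟨hm.add hm', M + M', fun y => (abs_add_le _ _).trans (add_le_add (hM y) (hM' y))⟩

theorem mul (hf : BddMeas f) (hg : BddMeas g) : BddMeas fun y => f y * g y := by
  obtain ⟨hm, M, hM⟩ := hf
  obtain ⟨hm', M', hM'⟩ := hg
  refine ⟨hm.mul hm', M * M', fun y => ?_⟩
  rw [abs_mul]
  exact mul_le_mul (hM y) (hM' y) (abs_nonneg _) ((abs_nonneg _).trans (hM y))

theorem const (c : ℝ) : BddMeas fun _ : Y => c := ⟨measurable_const, |c|, fun _ => le_rfl⟩

theorem sq (hf : BddMeas f) : BddMeas fun y => f y ^ 2 := by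
  simpa only [pow_two] using hf.mul hf

theorem comp (hf : BddMeas f) {φ : Z → Y} (hφ : Measurable φ) : BddMeas fun z => f (φ z) :=
  ⟨hf.1.comp hφ, hf.2.imp fun _ h z => h (φ z)⟩

theorem integral_right {F : Z × Y → ℝ} (hF : BddMeas F) (ν : Measure Z) [IsProbabilityMeasure ν] :
    BddMeas fun y => ∫ z, F (z, y) ∂ν := by
  obtain ⟨hm, M, hM⟩ := hF
  refine ⟨?_, M, fun y => ?_⟩
  · exact (StronglyMeasurable.integral_prod_left' (f := F) hm.stronglyMeasurable).measurable
  · have := norm_integral_le_of_norm_le_const (μ := ν) (f := fun z => F (z, y))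
      (ae_of_all _ fun z => hM (z, y))
    simpa using this

end BddMeas

/-- The mean minimizes the mean square distance to a constant. -/
theorem integral_sub_integral_sq_le {Y : Type*} [MeasurableSpace Y] (ν : Measure Y)
    [IsProbabilityMeasure ν] {f : Y → ℝ} (hf : BddMeas f) (c : ℝ) :
    ∫ y, (f y - ∫ z, f z ∂ν) ^ 2 ∂ν ≤ ∫ y, (f y - c) ^ 2 ∂ν := by
  set m := ∫ z, f z ∂ν with hm
  have h : ∀ y, (f y - c) ^ 2 = (f y - m) ^ 2 + (2 * (m - c) * (f y - m) + (m - c) ^ 2) :=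
    fun y => by ring
  have hfm : BddMeas fun y => f y - m := hf.sub (.const m)
  have h0 : ∫ y, (f y - m) ∂ν = 0 := by
    rw [integral_sub (hf.integrable ν) (integrable_const _)]
    simp [hm]
  simp_rw [h]
  rw [integral_add (hfm.sq.integrable ν)
    ((((BddMeas.const _).mul hfm).add (.const _)).integrable ν),
    integral_add (((BddMeas.const _).mul hfm).integrable ν) (integrable_const _),
    integral_const_mul, h0]
  simp only [mul_zero, integral_const, smul_eq_mul, zero_add, probReal_univ, one_mul]
  nlinarith [sq_nonneg (m - c)]

theorem sq_integral_le {Y : Type*} [MeasurableSpace Y] (ν : Measure Y)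
    [IsProbabilityMeasure ν] {f : Y → ℝ} (hf : BddMeas f) :
    (∫ y, f y ∂ν) ^ 2 ≤ ∫ y, f y ^ 2 ∂ν := by
  set m := ∫ z, f z ∂ν with hm
  have h : ∀ y, f y ^ 2 = (f y - m) ^ 2 + (2 * m * f y - m ^ 2) :=
    fun y => by ring
  have hfm : BddMeas fun y => f y - m := hf.sub (.const m)
  simp_rw [h]
  rw [integral_add (hfm.sq.integrable ν)
    ((((BddMeas.const _).mul hf).sub (.const _)).integrable ν),
    integral_sub (((BddMeas.const _).mul hf).integrable ν) (integrable_const _),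
    integral_const_mul, ← hm]
  have : 0 ≤ ∫ y, (f y - m) ^ 2 ∂ν := integral_nonneg fun _ => sq_nonneg _
  simp only [integral_const, smul_eq_mul, probReal_univ, one_mul]
  nlinarith

/-- Integration against a power of `μ`, one coordinate singled out. -/
theorem integral_pi_succAbove {n : ℕ} (i : Fin (n + 1)) {f : (Fin (n + 1) → X) → ℝ}
    (hf : BddMeas f) :
    ∫ x, f x ∂(Measure.pi fun _ => μ) =
      ∫ a, ∫ y, f (i.insertNth a y) ∂(Measure.pi fun _ : Fin n => μ) ∂μ := by
  have hmp := (measurePreserving_piFinSuccAbove (fun _ : Fin (n + 1) => μ) i).symm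
  rw [← hmp.integral_comp' f, integral_prod]
  · rfl
  · exact (hf.comp (MeasurableEquiv.measurable _)).integrable _

theorem measurable_insertNth {n : ℕ} (i : Fin (n + 1)) :
    Measurable fun p : X × (Fin n → X) => (i.insertNth p.1 p.2 : Fin (n + 1) → X) :=
  (MeasurableEquiv.piFinSuccAbove (fun _ => X) i).symm.measurable

/-- The **Efron–Stein inequality**: the variance of a function of independent variables is at most
the sum of the mean square errors made when, for each `i`, the function is approximated by one that
does not depend on the `i`-th variable. -/
theorem efron_stein : ∀ (n : ℕ) (f : (Fin n → X) → ℝ) (g : Fin n → (Fin n → X) → ℝ),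
    BddMeas f → (∀ i, BddMeas (g i)) → (∀ i x a, g i (Function.update x i a) = g i x) →
    ∫ x, (f x - ∫ z, f z ∂(Measure.pi fun _ => μ)) ^ 2 ∂(Measure.pi fun _ => μ) ≤
      ∑ i, ∫ x, (f x - g i x) ^ 2 ∂(Measure.pi fun _ => μ) := by
  intro n
  induction n with
  | zero =>
    intro f g _ _ _
    have : ∀ x, f x = f default := fun x => congrArg f (Subsingleton.elim _ _)
    simp [this]
  | succ n ih =>
    intro f g hf hg hgi
    set ν : Measure (Fin n → X) := Measure.pi fun _ => μ with hν
    set F : X × (Fin n → X) → ℝ := fun p => f ((0 : Fin (n + 1)).insertNth p.1 p.2) with hF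
    have hFb : BddMeas F := hf.comp (measurable_insertNth 0)
    set G : Fin (n + 1) → X × (Fin n → X) → ℝ :=
      fun i p => g i ((0 : Fin (n + 1)).insertNth p.1 p.2) with hG
    have hGb : ∀ i, BddMeas (G i) := fun i => (hg i).comp (measurable_insertNth 0)
    have hswap : ∀ H : X × (Fin n → X) → ℝ, BddMeas H →
        ∫ a, ∫ y, H (a, y) ∂ν ∂μ = ∫ y, ∫ a, H (a, y) ∂μ ∂ν := fun H hH =>
      integral_integral_swap (f := fun a y => H (a, y)) (hH.integrable _)
    set h : (Fin n → X) → ℝ := fun y => ∫ a, F (a, y) ∂μ with hh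
    have hhb : BddMeas h := hFb.integral_right μ
    have hmean : ∫ z, f z ∂(Measure.pi fun _ => μ) = ∫ y, h y ∂ν := by
      rw [integral_pi_succAbove μ 0 hf]
      exact hswap F hFb
    set m := ∫ y, h y ∂ν with hm
    have hsec : ∀ y, BddMeas fun a => F (a, y) := fun y => hFb.comp (by fun_prop)
    have hsecG : ∀ i y, BddMeas fun a => G i (a, y) := fun i y => (hGb i).comp (by fun_prop)
    -- Split the variance into the mean of the variance in the first variable and the variance of
    -- the mean over the first variable.
    have hsplit : ∀ y, ∫ a, (F (a, y) - m) ^ 2 ∂μ =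
        ∫ a, (F (a, y) - h y) ^ 2 ∂μ + (h y - m) ^ 2 := by
      intro y
      have e : ∀ a, (F (a, y) - m) ^ 2 = (F (a, y) - h y) ^ 2 +
          (2 * (h y - m) * (F (a, y) - h y) + (h y - m) ^ 2) := fun a => by ring
      have hb : BddMeas fun a => F (a, y) - h y := (hsec y).sub (.const _)
      have h0 : ∫ a, (F (a, y) - h y) ∂μ = 0 := by
        rw [integral_sub ((hsec y).integrable μ) (integrable_const _)]
        simp [hh]
      simp_rw [e]
      rw [integral_add (hb.sq.integrable μ)
        ((((BddMeas.const _).mul hb).add (.const _)).integrable μ),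
        integral_add (((BddMeas.const _).mul hb).integrable μ) (integrable_const _),
        integral_const_mul, h0]
      simp
    have hFh : BddMeas fun p : X × (Fin n → X) => F p - h p.2 :=
      hFb.sub (hhb.comp measurable_snd)
    rw [hmean, integral_pi_succAbove μ 0 (hf.sub (.const m)).sq, Fin.sum_univ_succ,
      hswap (fun p => (F p - m) ^ 2) (hFb.sub (.const m)).sq]
    simp_rw [hsplit]
    rw [integral_add ((hFh.sq.integral_right μ).integrable ν)
      ((hhb.sub (.const m)).sq.integrable ν)]
    refine add_le_add ?_ ?_
    · rw [integral_pi_succAbove μ 0 (hf.sub (hg 0)).sq,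
        hswap (fun p => (F p - G 0 p) ^ 2) (hFb.sub (hGb 0)).sq]
      refine integral_mono ((hFh.sq.integral_right μ).integrable ν)
        (((hFb.sub (hGb 0)).sq.integral_right μ).integrable ν) fun y => ?_
      obtain ⟨a₀⟩ : Nonempty X := nonempty_of_isProbabilityMeasure μ
      have hc : ∀ a, G 0 (a, y) = G 0 (a₀, y) := by
        intro a
        have := hgi 0 ((0 : Fin (n + 1)).insertNth a₀ y) a
        rw [Fin.update_insertNth] at this
        exact this
      simp only [hc]
      exact integral_sub_integral_sq_le μ (hsec y) _
    · refine (ih h (fun i y => ∫ a, G i.succ (a, y) ∂μ) hhb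
        (fun i => (hGb i.succ).integral_right μ) ?_).trans (Finset.sum_le_sum fun i _ => ?_)
      · intro i y b
        refine integral_congr_ae (ae_of_all _ fun a => ?_)
        have := hgi i.succ ((0 : Fin (n + 1)).insertNth a y) b
        simp only [hG]
        rw [← this]
        congr 1
        simp [Fin.insertNth_zero']
      · rw [integral_pi_succAbove μ 0 (hf.sub (hg i.succ)).sq,
          hswap (fun p => (F p - G i.succ p) ^ 2) (hFb.sub (hGb i.succ)).sq]
        refine integral_mono ((hhb.sub ((hGb i.succ).integral_right μ)).sq.integrable ν)
          (((hFb.sub (hGb i.succ)).sq.integral_right μ).integrable ν) fun y => ?_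
        simp only [hh]
        rw [← integral_sub ((hsec y).integrable μ) ((hsecG i.succ y).integrable μ)]
        exact sq_integral_le μ ((hsec y).sub (hsecG i.succ y))

end EfronStein

/-! ### The laws of the coordinates -/

theorem exp_div_four_le_sinh {r : ℝ} (hr : 1 ≤ r) : Real.exp r / 4 ≤ Real.sinh r := by
  rw [Real.sinh_eq]
  have h1 : 1 + r ≤ Real.exp r := by linarith [Real.add_one_le_exp r]
  have h2 : Real.exp (-r) ≤ 1 := Real.exp_le_one_iff.2 (by linarith)
  linarith

theorem sinh_le_exp_div_two (r : ℝ) : Real.sinh r ≤ Real.exp r / 2 := by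
  rw [Real.sinh_eq]
  linarith [Real.exp_pos (-r)]

theorem cosh_le_exp {r : ℝ} (hr : 0 ≤ r) : Real.cosh r ≤ Real.exp r := by
  rw [Real.cosh_eq]
  have : Real.exp (-r) ≤ Real.exp r := Real.exp_le_exp.2 (by linarith)
  linarith

theorem exp_div_two_le_cosh (r : ℝ) : Real.exp r / 2 ≤ Real.cosh r := by
  rw [Real.cosh_eq]
  linarith [Real.exp_pos (-r)]

theorem four_le_exp_two : (4 : ℝ) ≤ Real.exp 2 := by
  have h : (2 : ℝ) ≤ Real.exp 1 := by linarith [Real.add_one_le_exp (1 : ℝ)]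
  rw [show (2 : ℝ) = 1 + 1 by norm_num, Real.exp_add]
  nlinarith

theorem isProbabilityMeasure_radialMeasure {α R : ℝ} (hα : 0 < α) (hR : 0 < R) :
    IsProbabilityMeasure (radialMeasure α R) := by
  have hc : 0 < Real.cosh (α * R) - 1 := by
    linarith [Real.one_lt_cosh.2 (mul_pos hα hR).ne']
  refine ⟨?_⟩
  have hcont : Continuous fun r => α * Real.sinh (α * r) / (Real.cosh (α * R) - 1) := by fun_prop
  rw [radialMeasure, withDensity_apply _ MeasurableSet.univ, Measure.restrict_univ,
    ← ofReal_integral_eq_lintegral_ofReal hcont.integrableOn_Icc, integral_Icc_eq_integral_Ioc,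
    ← intervalIntegral.integral_of_le hR.le,
    intervalIntegral.integral_eq_sub_of_hasDerivAt
      (f := fun r => Real.cosh (α * r) / (Real.cosh (α * R) - 1)) _
      (hcont.intervalIntegrable _ _)]
  · simp only [mul_zero, Real.cosh_zero]
    rw [← sub_div, div_self hc.ne', ENNReal.ofReal_one]
  · intro r _
    have := ((Real.hasDerivAt_cosh (α * r)).comp r ((hasDerivAt_id r).const_mul α)).div_const
      (Real.cosh (α * R) - 1)
    rw [mul_one, mul_comm (Real.sinh _)] at this
    exact this
  · filter_upwards [ae_restrict_mem measurableSet_Icc] with r hr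
    have := Real.sinh_nonneg_iff.2 (mul_nonneg hα.le hr.1)
    exact div_nonneg (mul_nonneg hα.le this) hc.le

theorem ae_mem_Icc_radialMeasure (α R : ℝ) : ∀ᵐ r ∂radialMeasure α R, r ∈ Set.Icc 0 R :=
  (withDensity_absolutelyContinuous _ _).ae_le (ae_restrict_mem measurableSet_Icc)

theorem angularMeasure_eq : angularMeasure =
    ENNReal.ofReal (1 / (2 * Real.pi)) • volume.restrict (Set.Icc (-Real.pi) Real.pi) :=
  withDensity_const _

instance isProbabilityMeasure_angularMeasure : IsProbabilityMeasure angularMeasure := by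
  refine ⟨?_⟩
  rw [angularMeasure_eq, Measure.smul_apply, Measure.restrict_apply_univ, Real.volume_Icc,
    smul_eq_mul, ← ENNReal.ofReal_mul (by positivity)]
  rw [show 1 / (2 * Real.pi) * (Real.pi - -Real.pi) = 1 by field_simp; norm_num, ENNReal.ofReal_one]

theorem ae_mem_Icc_angularMeasure : ∀ᵐ θ ∂angularMeasure, θ ∈ Set.Icc (-Real.pi) Real.pi :=
  (withDensity_absolutelyContinuous _ _).ae_le (ae_restrict_mem measurableSet_Icc)

/-- The exponential moments of the radial coordinate below the exponent `α` are, up to a constant,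
those of a point at the boundary of the disc. -/
theorem lintegral_exp_radialMeasure_le {α R s : ℝ} (hα : 1 / 2 < α) (hR : 4 ≤ R) (hs : s < α) :
    ∫⁻ r, ENNReal.ofReal (Real.exp (-s * r)) ∂radialMeasure α R ≤
      ENNReal.ofReal (2 * α / (α - s) * Real.exp (-s * R)) := by
  have hαs : 0 < α - s := by linarith
  have hexp : 4 ≤ Real.exp (α * R) :=
    four_le_exp_two.trans (Real.exp_le_exp.2 (by nlinarith))
  have hc : Real.exp (α * R) / 4 ≤ Real.cosh (α * R) - 1 := by
    linarith [exp_div_two_le_cosh (α * R)]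
  have hint : IntegrableOn (fun r => 2 * α * Real.exp (-(α * R)) * Real.exp ((α - s) * r))
      (Set.Iic R) := (integrableOn_exp_mul_Iic hαs R).const_mul _
  rw [radialMeasure, lintegral_withDensity_eq_lintegral_mul _ (by fun_prop) (by fun_prop)]
  calc _ ≤ ∫⁻ r in Set.Icc 0 R,
        ENNReal.ofReal (2 * α * Real.exp (-(α * R)) * Real.exp ((α - s) * r)) := by
        refine lintegral_mono fun r => ?_
        rw [Pi.mul_apply, ← ENNReal.ofReal_mul' (Real.exp_nonneg _)]
        refine ENNReal.ofReal_le_ofReal ?_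
        rw [show (α - s) * r = α * r + -s * r by ring, Real.exp_add, ← mul_assoc]
        refine mul_le_mul_of_nonneg_right ?_ (Real.exp_nonneg _)
        rw [div_le_iff₀ (lt_of_lt_of_le (by positivity) hc)]
        calc α * Real.sinh (α * r) ≤ α * (Real.exp (α * r) / 2) := by
              gcongr
              exact sinh_le_exp_div_two _
          _ = 2 * α * Real.exp (-(α * R)) * Real.exp (α * r) * (Real.exp (α * R) / 4) := by
              rw [Real.exp_neg]
              field_simp
              norm_num
          _ ≤ _ := by gcongr
    _ ≤ ∫⁻ r in Set.Iic R,
        ENNReal.ofReal (2 * α * Real.exp (-(α * R)) * Real.exp ((α - s) * r)) :=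
        lintegral_mono_set Set.Icc_subset_Iic_self
    _ = _ := by
        rw [← ofReal_integral_eq_lintegral_ofReal hint (ae_of_all _ fun r => by positivity),
          integral_const_mul, integral_exp_mul_Iic hαs]
        congr 1
        rw [show (α - s) * R = α * R + -s * R by ring, Real.exp_add, Real.exp_neg (α * R)]
        field_simp

/-- A vertex lies in the outermost annulus of width one with probability bounded below. -/
theorem le_radialMeasure_Icc {α R : ℝ} (hα : 1 / 2 < α) (hR : 4 ≤ R) :
    ENNReal.ofReal (α / 4 * Real.exp (-α)) ≤ radialMeasure α R (Set.Icc (R - 1) R) := by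
  have h0 : 0 < α * R := by nlinarith
  have hc : 0 < Real.cosh (α * R) - 1 := by linarith [Real.one_lt_cosh.2 h0.ne']
  rw [radialMeasure, withDensity_apply _ measurableSet_Icc,
    Measure.restrict_restrict measurableSet_Icc,
    Set.inter_eq_self_of_subset_left (Set.Icc_subset_Icc_left (by linarith))]
  calc ENNReal.ofReal (α / 4 * Real.exp (-α))
      = ∫⁻ _ in Set.Icc (R - 1) R, ENNReal.ofReal (α / 4 * Real.exp (-α)) := by
        rw [setLIntegral_const, Real.volume_Icc]
        simp
    _ ≤ _ := by
        refine setLIntegral_mono (by fun_prop) fun r hr => ENNReal.ofReal_le_ofReal ?_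
        rw [le_div_iff₀ hc]
        have h1 : α * R - α ≤ α * r := by nlinarith [hr.1]
        have h2 : Real.exp (α * R - α) / 4 ≤ Real.sinh (α * r) :=
          (exp_div_four_le_sinh (by nlinarith)).trans (Real.sinh_le_sinh.2 h1)
        calc α / 4 * Real.exp (-α) * (Real.cosh (α * R) - 1)
            ≤ α / 4 * Real.exp (-α) * Real.exp (α * R) := by
              gcongr
              linarith [cosh_le_exp h0.le]
          _ = α * (Real.exp (α * R - α) / 4) := by
              rw [sub_eq_add_neg, Real.exp_add]
              ring
          _ ≤ _ := by gcongr

/-- On `[-π, π]` the sine is bounded below by the distance to `π ℤ`. -/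
theorem abs_le_or_of_abs_sin_le {y s : ℝ} (hy : |y| ≤ Real.pi) (h : |Real.sin y| ≤ s) :
    |y| ≤ Real.pi / 2 * s ∨ |y - Real.pi| ≤ Real.pi / 2 * s ∨ |y + Real.pi| ≤ Real.pi / 2 * s := by
  have hpi := Real.pi_pos
  -- It suffices to treat `y ∈ [0, π]`.
  have key : ∀ z, 0 ≤ z → z ≤ Real.pi → Real.sin z ≤ s →
      |z| ≤ Real.pi / 2 * s ∨ |z - Real.pi| ≤ Real.pi / 2 * s := by
    intro z h0 h1 h2
    rcases le_total z (Real.pi / 2) with hz | hz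
    · left
      have := Real.mul_le_sin h0 hz
      rw [abs_of_nonneg h0]
      calc z = Real.pi / 2 * (2 / Real.pi * z) := by field_simp
        _ ≤ _ := by gcongr; linarith
    · right
      have := Real.mul_le_sin (x := Real.pi - z) (by linarith) (by linarith)
      rw [Real.sin_pi_sub] at this
      rw [abs_sub_comm, abs_of_nonneg (by linarith)]
      calc Real.pi - z = Real.pi / 2 * (2 / Real.pi * (Real.pi - z)) := by field_simp
        _ ≤ _ := by gcongr; linarith
  rw [abs_le] at hy h
  rcases le_total 0 y with h0 | h0
  · exact (key y h0 hy.2 h.2).imp id Or.inl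
  · rcases key (-y) (by linarith) (by linarith) (by rw [Real.sin_neg]; linarith) with h' | h'
    · left
      rwa [abs_neg] at h'
    · right; right
      rwa [← abs_neg, neg_sub, sub_neg_eq_add, add_comm] at h'

theorem angularMeasure_abs_sin_le {θ s : ℝ} (hθ : θ ∈ Set.Icc (-Real.pi) Real.pi) (hs : 0 ≤ s) :
    angularMeasure {θ' | |Real.sin ((θ - θ') / 2)| ≤ s} ≤ ENNReal.ofReal (3 * s) := by
  have hpi := Real.pi_pos
  rw [angularMeasure_eq, Measure.smul_apply, smul_eq_mul,
    Measure.restrict_apply' measurableSet_Icc]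
  have hsub : {θ' | |Real.sin ((θ - θ') / 2)| ≤ s} ∩ Set.Icc (-Real.pi) Real.pi ⊆
      Metric.closedBall θ (Real.pi * s) ∪ (Metric.closedBall (θ - 2 * Real.pi) (Real.pi * s) ∪
        Metric.closedBall (θ + 2 * Real.pi) (Real.pi * s)) := by
    rintro θ' ⟨h, h'⟩
    have hy : |(θ - θ') / 2| ≤ Real.pi := by
      rw [abs_le]
      constructor <;> linarith [hθ.1, hθ.2, h'.1, h'.2]
    simp only [Set.mem_union, Metric.mem_closedBall, Real.dist_eq, abs_le]
    rcases abs_le_or_of_abs_sin_le hy h with h | h | h <;> rw [abs_le] at h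
    · left; constructor <;> linarith [h.1, h.2]
    · right; left; constructor <;> linarith [h.1, h.2]
    · right; right; constructor <;> linarith [h.1, h.2]
  calc _ ≤ ENNReal.ofReal (1 / (2 * Real.pi)) * (ENNReal.ofReal (2 * (Real.pi * s)) +
        (ENNReal.ofReal (2 * (Real.pi * s)) + ENNReal.ofReal (2 * (Real.pi * s)))) := by
        gcongr
        refine (measure_mono hsub).trans ((measure_union_le _ _).trans ?_)
        rw [Real.volume_closedBall]
        gcongr
        refine (measure_union_le _ _).trans ?_
        rw [Real.volume_closedBall, Real.volume_closedBall]
    _ = _ := by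
        rw [← ENNReal.ofReal_add (by positivity) (by positivity),
          ← ENNReal.ofReal_add (by positivity) (by positivity),
          ← ENNReal.ofReal_mul (by positivity)]
        congr 1
        field_simp
        ring

/-! ### Neighborhoods -/

/-- The set of coordinates at hyperbolic distance at most `R` from the point with coordinates
`p`. -/
def nbhd (R : ℝ) (p : ℝ × ℝ) : Set (ℝ × ℝ) := {q | hypDist p.1 q.1 (p.2 - q.2) ≤ R}

theorem hypDist_le_iff {R : ℝ} (hR : 0 ≤ R) (r r' φ : ℝ) :
    hypDist r r' φ ≤ R ↔
      Real.cosh r * Real.cosh r' - Real.sinh r * Real.sinh r' * Real.cos φ ≤ Real.cosh R := by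
  rw [← cosh_hypDist, Real.cosh_le_cosh, abs_of_nonneg (hypDist_nonneg _ _ _), abs_of_nonneg hR]

theorem measurableSet_hypDist_le {R : ℝ} (hR : 0 ≤ R) :
    MeasurableSet {p : (ℝ × ℝ) × (ℝ × ℝ) | hypDist p.1.1 p.2.1 (p.1.2 - p.2.2) ≤ R} := by
  simp only [hypDist_le_iff hR]
  exact (isClosed_le (by fun_prop) (by fun_prop)).measurableSet

theorem measurableSet_nbhd {R : ℝ} (hR : 0 ≤ R) (p : ℝ × ℝ) : MeasurableSet (nbhd R p) :=
  measurable_prodMk_left (measurableSet_hypDist_le hR)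

/-- Two vertices at radii `r` and `r'` are adjacent only if the sine of half their angular
difference is `O(e ^ ((R - r - r') / 2))`; the factor `9` makes the bound trivially true when one of
the radii is less than one. -/
theorem angularMeasure_hypDist_le {R r r' θ : ℝ} (hr : r ∈ Set.Icc 0 R) (hr' : r' ∈ Set.Icc 0 R)
    (hθ : θ ∈ Set.Icc (-Real.pi) Real.pi) :
    angularMeasure {θ' | hypDist r r' (θ - θ') ≤ R} ≤
      ENNReal.ofReal (9 * Real.exp ((R - r) / 2) * Real.exp (-(1 / 2) * r')) := by
  have hR : 0 ≤ R := hr.1.trans hr.2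
  rw [mul_assoc, ← Real.exp_add, show (R - r) / 2 + -(1 / 2) * r' = (R - r - r') / 2 by ring]
  by_cases h1 : 1 ≤ r ∧ 1 ≤ r'
  · rw [show 9 * Real.exp ((R - r - r') / 2) = 3 * (3 * Real.exp ((R - r - r') / 2)) by ring]
    refine (measure_mono ?_).trans (angularMeasure_abs_sin_le hθ (by positivity))
    intro θ' h
    simp only [Set.mem_ofPred_eq] at h ⊢
    rw [hypDist_le_iff hR] at h
    set y := (θ - θ') / 2 with hy
    rw [show θ - θ' = 2 * y by rw [hy]; ring, Real.cos_two_mul', Real.cos_sq'] at h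
    refine abs_le_of_sq_le_sq ?_ (by positivity)
    have hs := exp_div_four_le_sinh h1.1
    have hs' := exp_div_four_le_sinh h1.2
    have hcc : Real.sinh r * Real.sinh r' ≤ Real.cosh r * Real.cosh r' :=
      mul_le_mul (Real.sinh_lt_cosh r).le (Real.sinh_lt_cosh r').le
        (Real.sinh_nonneg_iff.2 hr'.1) (Real.cosh_pos _).le
    have hprod : Real.exp r / 4 * (Real.exp r' / 4) ≤ Real.sinh r * Real.sinh r' :=
      mul_le_mul hs hs' (by positivity) (Real.sinh_nonneg_iff.2 hr.1)
    have hmain : Real.exp r / 4 * (Real.exp r' / 4) * (2 * Real.sin y ^ 2) ≤ Real.exp R := by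
      have := mul_le_mul_of_nonneg_right hprod (show 0 ≤ 2 * Real.sin y ^ 2 by positivity)
      nlinarith [cosh_le_exp hR]
    have he : (3 * Real.exp ((R - r - r') / 2)) ^ 2 = 9 * Real.exp (R - r - r') := by
      rw [mul_pow, ← Real.exp_nat_mul]
      push_cast
      ring_nf
    have he' : Real.exp R = Real.exp (R - r - r') * (Real.exp r * Real.exp r') := by
      rw [← Real.exp_add, ← Real.exp_add]
      ring_nf
    rw [he]
    rw [he'] at hmain
    have hpos : 0 < Real.exp r * Real.exp r' := by positivity
    have h8 : Real.sin y ^ 2 ≤ 8 * Real.exp (R - r - r') := by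
      refine le_of_mul_le_mul_right ?_ hpos
      nlinarith
    linarith [Real.exp_pos (R - r - r')]
  · refine prob_le_one.trans ?_
    rw [← ENNReal.ofReal_one]
    refine ENNReal.ofReal_le_ofReal ?_
    have h2 : -(1 / 2) ≤ (R - r - r') / 2 := by
      rw [not_and_or, not_le, not_le] at h1
      rcases h1 with h1 | h1
      · linarith [hr'.2]
      · linarith [hr.2]
    have := Real.add_one_le_exp ((R - r - r') / 2)
    linarith

/-- The common law of the coordinates of a vertex. -/
def coordLaw (α R : ℝ) : Measure (ℝ × ℝ) := (radialMeasure α R).prod angularMeasure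

theorem isProbabilityMeasure_coordLaw {α R : ℝ} (hα : 1 / 2 < α) (hR : 4 ≤ R) :
    IsProbabilityMeasure (coordLaw α R) := by
  have := isProbabilityMeasure_radialMeasure (by linarith : 0 < α) (by linarith : 0 < R)
  unfold coordLaw
  infer_instance

theorem isProbabilityMeasure_coordMeasure {α C : ℝ} (hα : 1 / 2 < α) {n : ℕ}
    (hR : 4 ≤ radius C n) : IsProbabilityMeasure (coordMeasure α C n) :=
  have := isProbabilityMeasure_coordLaw hα hR
  inferInstanceAs (IsProbabilityMeasure (Measure.pi fun _ => coordLaw α (radius C n)))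

theorem ae_mem_coordLaw {α R : ℝ} (hα : 1 / 2 < α) (hR : 4 ≤ R) :
    ∀ᵐ p ∂coordLaw α R, p.1 ∈ Set.Icc 0 R ∧ p.2 ∈ Set.Icc (-Real.pi) Real.pi := by
  have := isProbabilityMeasure_radialMeasure (by linarith : 0 < α) (by linarith : 0 < R)
  exact (Measure.quasiMeasurePreserving_fst.ae (ae_mem_Icc_radialMeasure α R)).and
    (Measure.quasiMeasurePreserving_snd.ae ae_mem_Icc_angularMeasure)

/-- A vertex at radius `r` is adjacent to another given vertex with probability `O(e ^ (-r / 2))`.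
This is where `α > 1 / 2` enters. -/
theorem coordLaw_nbhd_le {α R : ℝ} (hα : 1 / 2 < α) (hR : 4 ≤ R) {p : ℝ × ℝ}
    (h₁ : p.1 ∈ Set.Icc 0 R) (h₂ : p.2 ∈ Set.Icc (-Real.pi) Real.pi) :
    (coordLaw α R).real (nbhd R p) ≤ 18 * α / (α - 1 / 2) * Real.exp (-(1 / 2) * p.1) := by
  have hα' : 0 < α - 1 / 2 := by linarith
  have := isProbabilityMeasure_radialMeasure (by linarith : 0 < α) (by linarith : 0 < R)
  refine ENNReal.toReal_le_of_le_ofReal (by positivity) ?_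
  rw [coordLaw, Measure.prod_apply (measurableSet_nbhd (by linarith) p)]
  calc _ ≤ ∫⁻ r', ENNReal.ofReal (9 * Real.exp ((R - p.1) / 2)) *
        ENNReal.ofReal (Real.exp (-(1 / 2) * r')) ∂radialMeasure α R := by
        refine lintegral_mono_ae ?_
        filter_upwards [ae_mem_Icc_radialMeasure α R] with r' hr'
        rw [← ENNReal.ofReal_mul (by positivity)]
        exact angularMeasure_hypDist_le h₁ hr' h₂
    _ ≤ ENNReal.ofReal (9 * Real.exp ((R - p.1) / 2)) *
        ENNReal.ofReal (2 * α / (α - 1 / 2) * Real.exp (-(1 / 2) * R)) := by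
        rw [lintegral_const_mul _ (by fun_prop)]
        gcongr
        exact lintegral_exp_radialMeasure_le hα hR hα
    _ = _ := by
        rw [← ENNReal.ofReal_mul (by positivity)]
        congr 1
        rw [show (R - p.1) / 2 = -(1 / 2) * p.1 + -(-(1 / 2) * R) by ring, Real.exp_add,
          Real.exp_neg (-(1 / 2) * R)]
        field_simp
        norm_num

theorem integrable_exp_coordLaw {α R s : ℝ} (hα : 1 / 2 < α) (hR : 4 ≤ R) (hs : 0 ≤ s) :
    Integrable (fun p => Real.exp (-s * p.1)) (coordLaw α R) := by
  have := isProbabilityMeasure_coordLaw hα hR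
  refine Integrable.of_bound (by fun_prop) 1 ?_
  filter_upwards [ae_mem_coordLaw hα hR] with p hp
  rw [Real.norm_eq_abs, Real.abs_exp, Real.exp_le_one_iff]
  nlinarith [hp.1.1]

theorem integral_exp_coordLaw_le {α R s : ℝ} (hα : 1 / 2 < α) (hR : 4 ≤ R) (hs : s < α) :
    ∫ p, Real.exp (-s * p.1) ∂coordLaw α R ≤ 2 * α / (α - s) * Real.exp (-s * R) := by
  have := isProbabilityMeasure_radialMeasure (by linarith : 0 < α) (by linarith : 0 < R)
  have hs' : 0 < α - s := by linarith
  have hα0 : 0 < α := by linarith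
  rw [coordLaw, integral_fun_fst (f := fun r => Real.exp (-s * r)), probReal_univ, one_smul,
    integral_eq_lintegral_of_nonneg_ae (ae_of_all _ fun r => Real.exp_nonneg _) (by fun_prop)]
  exact ENNReal.toReal_le_of_le_ofReal (by positivity) (lintegral_exp_radialMeasure_le hα hR hs)

/-! ### Counting the points of an independent sample in a set -/

section Sampling

variable {X : Type*} [MeasurableSpace X] (μ : Measure X) [IsProbabilityMeasure μ]

theorem bddMeas_indicator {A : Set X} (hA : MeasurableSet A) :
    BddMeas (A.indicator fun _ => (1 : ℝ)) := by
  refine ⟨measurable_const.indicator hA, 1, fun y => ?_⟩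
  by_cases h : y ∈ A <;> simp [h]

theorem bddMeas_sum {ι Y : Type*} [MeasurableSpace Y] (s : Finset ι) {f : ι → Y → ℝ}
    (hf : ∀ i ∈ s, BddMeas (f i)) : BddMeas fun y => ∑ i ∈ s, f i y := by
  classical
  induction s using Finset.induction_on with
  | empty => simpa using BddMeas.const 0
  | insert i s hi ih =>
    simp only [Finset.sum_insert hi]
    exact (hf i (Finset.mem_insert_self i s)).add
      (ih fun j hj => hf j (Finset.mem_insert_of_mem hj))

theorem integral_indicator_mul_indicator {m : ℕ} {A : Set X} (hA : MeasurableSet A)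
    (j k : Fin m) :
    ∫ y, A.indicator (fun _ => (1 : ℝ)) (y j) * A.indicator (fun _ => (1 : ℝ)) (y k)
      ∂(Measure.pi fun _ => μ) = if j = k then μ.real A else μ.real A ^ 2 := by
  have hprod : ∀ y : Fin m → X,
      A.indicator (fun _ => (1 : ℝ)) (y j) * A.indicator (fun _ => (1 : ℝ)) (y k) =
        ∏ l, (if l ∈ ({j, k} : Finset (Fin m)) then A.indicator (fun _ => (1 : ℝ))
          else fun _ => 1) (y l) := by
    intro y
    simp only [ite_apply]
    rw [Finset.prod_ite_mem, Finset.univ_inter]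
    by_cases hjk : j = k
    · subst hjk
      by_cases h : y j ∈ A <;> simp [h]
    · rw [Finset.prod_pair hjk]
  simp_rw [hprod]
  rw [integral_fintype_prod_eq_prod (𝕜 := ℝ) (fun l => (if l ∈ ({j, k} : Finset (Fin m)) then
    A.indicator (fun _ => (1 : ℝ)) else fun _ => 1))]
  have : ∀ l, ∫ x, (if l ∈ ({j, k} : Finset (Fin m)) then A.indicator (fun _ => (1 : ℝ))
      else fun _ => 1) x ∂μ = if l ∈ ({j, k} : Finset (Fin m)) then μ.real A else 1 := by
    intro l
    split_ifs
    · rw [integral_indicator hA]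
      simp
    · simp
  simp_rw [this]
  rw [Finset.prod_ite_mem, Finset.univ_inter, Finset.prod_const]
  split_ifs with hjk
  · simp [hjk]
  · rw [Finset.card_pair hjk]

/-- Up to constants, the second moment of one plus the number of points in `A` of a sample of
size `m`. -/
theorem integral_one_add_count_sq_le (m : ℕ) {A : Set X} (hA : MeasurableSet A) :
    ∫ y, (1 + ∑ j : Fin m, A.indicator (fun _ => (1 : ℝ)) (y j)) ^ 2 ∂(Measure.pi fun _ => μ) ≤
      2 + 2 * (m * μ.real A + m ^ 2 * μ.real A ^ 2) := by
  set f : Fin m → (Fin m → X) → ℝ := fun j y => A.indicator (fun _ => (1 : ℝ)) (y j) with hf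
  have hfb : ∀ j, BddMeas (f j) := fun j => (bddMeas_indicator hA).comp (measurable_pi_apply j)
  have hS : BddMeas fun y => ∑ j, f j y := bddMeas_sum _ fun j _ => hfb j
  have hSS : BddMeas fun y => ∑ j, ∑ k, f j y * f k y :=
    bddMeas_sum _ fun j _ => bddMeas_sum _ fun k _ => (hfb j).mul (hfb k)
  calc _ ≤ ∫ y, (2 + 2 * ∑ j, ∑ k, f j y * f k y) ∂(Measure.pi fun _ => μ) := by
        refine integral_mono (((BddMeas.const 1).add hS).sq.integrable _)
          (((BddMeas.const 2).add ((BddMeas.const 2).mul hSS)).integrable _) fun y => ?_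
        simp only
        rw [← Finset.sum_mul_sum]
        nlinarith [sq_nonneg (1 - ∑ j, f j y)]
    _ = 2 + 2 * ∑ j : Fin m, ∑ k : Fin m, if j = k then μ.real A else μ.real A ^ 2 := by
        rw [integral_add (integrable_const _) (((BddMeas.const 2).mul hSS).integrable _),
          integral_const_mul, integral_finsetSum _ fun j _ =>
            (bddMeas_sum _ fun k _ => (hfb j).mul (hfb k)).integrable _]
        simp only [integral_const, probReal_univ, one_smul]
        congr 2
        refine Finset.sum_congr rfl fun j _ => ?_
        rw [integral_finsetSum _ fun k _ => ((hfb j).mul (hfb k)).integrable _]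
        exact Finset.sum_congr rfl fun k _ => integral_indicator_mul_indicator μ hA j k
    _ ≤ 2 + 2 * ∑ j : Fin m, ∑ k : Fin m, ((if j = k then μ.real A else 0) + μ.real A ^ 2) := by
        gcongr with j _ k _
        split_ifs
        · exact le_add_of_nonneg_right (sq_nonneg _)
        · rw [zero_add]
    _ = _ := by
        simp [Finset.sum_add_distrib]
        ring

/-- The event that the sample points in `N` are exactly those with index in `T`, and that they even
lie in `A`. -/
def exactBox {m : ℕ} (A N : Set X) (T : Finset (Fin m)) : Set (Fin m → X) :=
  Set.univ.pi fun l => if l ∈ T then A else Nᶜ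

theorem measurableSet_exactBox {m : ℕ} {A N : Set X} (hA : MeasurableSet A) (hN : MeasurableSet N)
    (T : Finset (Fin m)) : MeasurableSet (exactBox A N T) := by
  refine MeasurableSet.univ_pi fun l => ?_
  split_ifs
  exacts [hA, hN.compl]

theorem measureReal_exactBox {m : ℕ} (A : Set X) {N : Set X} (hN : MeasurableSet N)
    (T : Finset (Fin m)) : (Measure.pi fun _ => μ).real (exactBox A N T) =
      μ.real A ^ T.card * (1 - μ.real N) ^ (m - T.card) := by
  rw [exactBox, measureReal_def, Measure.pi_pi, ENNReal.toReal_prod]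
  have : ∀ l, (μ (if l ∈ T then A else Nᶜ)).toReal =
      if l ∈ T then μ.real A else 1 - μ.real N := by
    intro l
    split_ifs
    · rfl
    · rw [← probReal_compl_eq_one_sub hN]
      rfl
  simp_rw [this]
  rw [Finset.prod_ite, Finset.prod_const, Finset.prod_const]
  congr 2
  · congr 1
    ext l
    simp
  · rw [Finset.filter_not, Finset.card_sdiff_of_subset (Finset.filter_subset _ _)]
    simp

end Sampling

theorem mem_iff_of_mem_exactBox {X : Type*} {m : ℕ} {A N : Set X} (hAN : A ⊆ N) {T : Finset (Fin m)}
    {y : Fin m → X} (hy : y ∈ exactBox A N T) (l : Fin m) : y l ∈ N ↔ l ∈ T := by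
  have := hy l trivial
  by_cases h : l ∈ T
  · simp only [h, if_true] at this
    exact iff_of_true (hAN this) h
  · simp only [h, if_false] at this
    exact iff_of_false this h

/-! ### Measurability in the coordinates -/

theorem measurableSet_graph_adj {R : ℝ} (hR : 0 ≤ R) {n : ℕ} (u v : Fin n) :
    MeasurableSet {x : Fin n → ℝ × ℝ | (graph R x).Adj u v} := by
  have h : Measurable fun x : Fin n → ℝ × ℝ => (x u, x v) := by fun_prop
  exact (MeasurableSet.const (u ≠ v)).inter (h (measurableSet_hypDist_le hR))

/-- Every graph parameter is a bounded measurable function of the coordinates, as there are only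
finitely many graphs. -/
theorem bddMeas_graph {R : ℝ} (hR : 0 ≤ R) {n : ℕ} (F : SimpleGraph (Fin n) → ℝ) :
    BddMeas fun x : Fin n → ℝ × ℝ => F (graph R x) := by
  constructor
  · let _ : MeasurableSpace (SimpleGraph (Fin n)) := ⊤
    have : MeasurableSingletonClass (SimpleGraph (Fin n)) := ⟨fun _ => trivial⟩
    refine (measurable_from_top (f := F)).comp (measurable_to_countable' fun G => ?_)
    have : graph R ⁻¹' {G} =
        ⋂ u, ⋂ v, {x : Fin n → ℝ × ℝ | (graph R x).Adj u v ↔ G.Adj u v} := by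
      ext x
      simp only [Set.mem_preimage, Set.mem_singleton_iff, Set.mem_iInter, Set.mem_ofPred_eq]
      exact ⟨fun h u v => by rw [h], fun h => SimpleGraph.ext (by ext u v; exact h u v)⟩
    rw [this]
    refine MeasurableSet.iInter fun u => MeasurableSet.iInter fun v => ?_
    by_cases h : G.Adj u v
    · simpa [h] using measurableSet_graph_adj hR u v
    · simp only [h, iff_false]
      exact (measurableSet_graph_adj hR u v).compl
  · obtain ⟨M, hM⟩ := (Set.finite_range fun G => |F G|).bddAbove
    exact ⟨M, fun x => hM ⟨_, rfl⟩⟩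

theorem graph_insertNth_adj {R : ℝ} {m : ℕ} (i : Fin (m + 1)) (p : ℝ × ℝ) (y : Fin m → ℝ × ℝ)
    (j : Fin m) :
    (graph R (i.insertNth p y : Fin (m + 1) → ℝ × ℝ)).Adj i (i.succAbove j) ↔
      y j ∈ nbhd R p := by
  simp [graph, nbhd]

theorem graph_insertNth_adj_succAbove {R : ℝ} {m : ℕ} (i : Fin (m + 1)) (p : ℝ × ℝ)
    (y : Fin m → ℝ × ℝ) (j k : Fin m) :
    (graph R (i.insertNth p y : Fin (m + 1) → ℝ × ℝ)).Adj (i.succAbove j) (i.succAbove k) ↔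
      j ≠ k ∧ y k ∈ nbhd R (y j) := by
  simp [graph, nbhd]

theorem deleteIncidenceSet_graph_update {R : ℝ} {n : ℕ} (i : Fin n) (x : Fin n → ℝ × ℝ)
    (a : ℝ × ℝ) : (graph R (Function.update x i a)).deleteIncidenceSet i =
      (graph R x).deleteIncidenceSet i := by
  ext u v
  simp only [SimpleGraph.deleteIncidenceSet_adj]
  refine and_congr_left fun ⟨hu, hv⟩ => ?_
  simp [graph, hu, hv]

/-! ### The variance of the clustering coefficient -/

open Classical in
/-- The second moment of a degree, by conditioning on the coordinates of the vertex. As `α ≤ 1` is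
possible, `e ^ (-r)` may have no mean of order `e ^ (-R)`, whence the smaller exponent `s`. -/
theorem integral_one_add_degree_sq_le {α R s : ℝ} (hα : 1 / 2 < α) (hR : 4 ≤ R) (hs : s < α)
    (hs0 : 0 ≤ s) (hs1 : s ≤ 1) {n : ℕ} (i : Fin n) :
    ∫ x, (1 + ((Finset.univ.filter fun j => (graph R x).Adj i j).card : ℝ)) ^ 2
        ∂(Measure.pi fun _ => coordLaw α R) ≤
      2 + 2 * (n * (18 * α / (α - 1 / 2) * (2 * α / (α - 1 / 2) * Real.exp (-(1 / 2) * R))) +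
        n ^ 2 * ((18 * α / (α - 1 / 2)) ^ 2 * (2 * α / (α - s) * Real.exp (-s * R)))) := by
  have := isProbabilityMeasure_coordLaw hα hR
  have hR0 : 0 ≤ R := by linarith
  obtain ⟨m, rfl⟩ : ∃ m, n = m + 1 := ⟨n - 1, by have := i.pos; omega⟩
  have hbm := bddMeas_graph hR0 fun G : SimpleGraph (Fin (m + 1)) =>
    (1 + ((Finset.univ.filter fun j => G.Adj i j).card : ℝ)) ^ 2
  set K := 18 * α / (α - 1 / 2) with hK
  have hα' : 0 < α - 1 / 2 := by linarith
  have hαs : 0 < α - s := by linarith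
  have hα0 : 0 < α := by linarith
  have hK0 : 0 ≤ K := by positivity
  have hcount : ∀ p (y : Fin m → ℝ × ℝ),
      ((Finset.univ.filter fun j => (graph R (i.insertNth p y : Fin (m + 1) → ℝ × ℝ)).Adj i j).card
        : ℝ) = ∑ j, (nbhd R p).indicator (fun _ => (1 : ℝ)) (y j) := by
    intro p y
    rw [Finset.card_filter, Nat.cast_sum, Fin.sum_univ_succAbove _ i]
    simp only [SimpleGraph.irrefl, if_false, Nat.cast_zero, zero_add, graph_insertNth_adj]
    refine Finset.sum_congr rfl fun j _ => ?_
    by_cases h : y j ∈ nbhd R p <;> simp [h]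
  rw [integral_pi_succAbove _ i hbm]
  simp only [hcount]
  have hint : ∀ t, 0 ≤ t → Integrable (fun p => Real.exp (-t * p.1)) (coordLaw α R) :=
    fun t ht => integrable_exp_coordLaw hα hR ht
  calc _ ≤ ∫ p, (2 + 2 * (((m + 1 : ℕ) : ℝ) * (K * Real.exp (-(1 / 2) * p.1)) +
        ((m + 1 : ℕ) : ℝ) ^ 2 * (K ^ 2 * Real.exp (-s * p.1)))) ∂coordLaw α R := by
        refine integral_mono_of_nonneg (ae_of_all _ fun p => integral_nonneg fun y => sq_nonneg _)
          ((integrable_const _).add (((((hint _ (by norm_num)).const_mul _).const_mul _).add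
            (((hint s hs0).const_mul _).const_mul _)).const_mul _)) ?_
        filter_upwards [ae_mem_coordLaw hα hR] with p hp
        refine (integral_one_add_count_sq_le _ m (measurableSet_nbhd hR0 p)).trans ?_
        have hq := coordLaw_nbhd_le hα hR hp.1 hp.2
        have hq2 : (coordLaw α R).real (nbhd R p) ^ 2 ≤ K ^ 2 * Real.exp (-s * p.1) := by
          refine (pow_le_pow_left₀ measureReal_nonneg hq 2).trans ?_
          rw [mul_pow, ← Real.exp_nat_mul]
          refine mul_le_mul_of_nonneg_left (Real.exp_le_exp.2 ?_) (by positivity)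
          push_cast
          nlinarith [hp.1.1]
        have hm : (m : ℝ) ≤ ((m + 1 : ℕ) : ℝ) := by push_cast; linarith
        have := measureReal_nonneg (μ := coordLaw α R) (s := nbhd R p)
        gcongr
    _ = 2 + 2 * (((m + 1 : ℕ) : ℝ) * (K * ∫ p, Real.exp (-(1 / 2) * p.1) ∂coordLaw α R) +
        ((m + 1 : ℕ) : ℝ) ^ 2 * (K ^ 2 * ∫ p, Real.exp (-s * p.1) ∂coordLaw α R)) := by
        have h1 := ((hint (1 / 2) (by norm_num)).const_mul K).const_mul ((m + 1 : ℕ) : ℝ)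
        have h2 := ((hint s hs0).const_mul (K ^ 2)).const_mul (((m + 1 : ℕ) : ℝ) ^ 2)
        have h3 : Integrable (fun p : ℝ × ℝ => 2 * (((m + 1 : ℕ) : ℝ) *
            (K * Real.exp (-(1 / 2) * p.1)) + ((m + 1 : ℕ) : ℝ) ^ 2 *
              (K ^ 2 * Real.exp (-s * p.1)))) (coordLaw α R) := (h1.add h2).const_mul 2
        rw [integral_add (integrable_const _) h3, integral_const_mul,
          integral_add h1 h2]
        simp only [integral_const_mul, integral_const, probReal_univ, one_smul]
    _ ≤ _ := by
        gcongr
        · exact integral_exp_coordLaw_le hα hR hα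
        · exact integral_exp_coordLaw_le hα hR hs

theorem bddMeas_clustering {C : ℝ} {n : ℕ} (hR : 0 ≤ radius C n) : BddMeas (clustering C n) :=
  bddMeas_graph hR globalClustering

/-- The Efron–Stein bound for `c̄`, comparing it for each `i` with the clustering coefficient of the
graph without the edges at `i`. -/
theorem variance_clustering_le {α C s : ℝ} (hα : 1 / 2 < α) (hs : s < α)
    (hs0 : 0 ≤ s) (hs1 : s ≤ 1) {n : ℕ} (hR : 4 ≤ radius C n) :
    ∫ x, (clustering C n x - expectedClustering α C n) ^ 2 ∂(coordMeasure α C n) ≤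
      1 / n * (2 + 2 * (n * (18 * α / (α - 1 / 2) *
        (2 * α / (α - 1 / 2) * Real.exp (-(1 / 2) * radius C n))) +
        n ^ 2 * ((18 * α / (α - 1 / 2)) ^ 2 *
          (2 * α / (α - s) * Real.exp (-s * radius C n))))) := by
  classical
  have := isProbabilityMeasure_coordLaw hα hR
  have hR0 : 0 ≤ radius C n := by linarith
  set R := radius C n with hRdef
  have hg : ∀ i : Fin n, BddMeas fun x : Fin n → ℝ × ℝ =>
      globalClustering ((graph R x).deleteIncidenceSet i) :=
    fun i => bddMeas_graph hR0 fun G => globalClustering (G.deleteIncidenceSet i)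
  have hf : BddMeas fun x : Fin n → ℝ × ℝ => globalClustering (graph R x) :=
    bddMeas_graph hR0 globalClustering
  have hES := efron_stein (coordLaw α R) n _ _ hf hg
    fun i x a => by simp only [deleteIncidenceSet_graph_update]
  refine hES.trans ?_
  refine (Finset.sum_le_sum (g := fun _ => (1 / (n : ℝ)) ^ 2 * (2 + 2 * (n * (18 * α /
    (α - 1 / 2) * (2 * α / (α - 1 / 2) * Real.exp (-(1 / 2) * R))) + n ^ 2 *
      ((18 * α / (α - 1 / 2)) ^ 2 * (2 * α / (α - s) * Real.exp (-s * R))))))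
      fun i _ => ?_).trans (le_of_eq ?_)
  · refine le_trans ?_ (mul_le_mul_of_nonneg_left
      (integral_one_add_degree_sq_le hα hR hs hs0 hs1 i) (by positivity))
    rw [← integral_const_mul]
    refine integral_mono ((hf.sub (hg i)).sq.integrable _)
      (((bddMeas_graph hR0 fun G : SimpleGraph (Fin n) => (1 / (n : ℝ)) ^ 2 *
        (1 + ((Finset.univ.filter fun j => G.Adj i j).card : ℝ)) ^ 2).integrable _)) fun x => ?_
    have h := abs_globalClustering_sub_deleteIncidenceSet_le (graph R x) i
    rw [Fintype.card_fin] at h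
    simp only
    rw [← mul_pow, ← sq_abs]
    exact pow_le_pow_left₀ (abs_nonneg _) (by convert h) 2
  · rw [Finset.sum_const, Finset.card_univ, Fintype.card_fin, nsmul_eq_mul, ← mul_assoc]
    congr 1
    rcases eq_or_ne (n : ℝ) 0 with h | h
    · simp [h]
    · field_simp

/-! ### A lower bound for the expected local clustering coefficient -/

/-- Points near the boundary of the disc with angular difference at most `e ^ (-R / 2)` are
adjacent. -/
theorem hypDist_le_of_close {R r r' φ : ℝ} (hR : 4 ≤ R) (hr : r ∈ Set.Icc (R - 1) R)
    (hr' : r' ∈ Set.Icc (R - 1) R) (hφ : |φ| ≤ Real.exp (-(1 / 2) * R)) :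
    hypDist r r' φ ≤ R := by
  rw [hypDist_le_iff (by linarith)]
  have h1 : Real.cosh (r - r') ≤ Real.cosh 1 := by
    rw [Real.cosh_le_cosh, abs_one, abs_le]
    constructor <;> linarith [hr.1, hr.2, hr'.1, hr'.2]
  have h2 : Real.cosh 1 ≤ 3 :=
    (cosh_le_exp zero_le_one).trans (Real.exp_one_lt_d9.le.trans (by norm_num))
  have hsinh : ∀ t ∈ Set.Icc (R - 1) R, 0 ≤ Real.sinh t ∧ Real.sinh t ≤ Real.exp R / 2 :=
    fun t ht => ⟨Real.sinh_nonneg_iff.2 (by linarith [ht.1]), (sinh_le_exp_div_two t).trans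
      (by gcongr; exact ht.2)⟩
  have h3 : Real.sinh r * Real.sinh r' ≤ Real.exp R / 2 * (Real.exp R / 2) :=
    mul_le_mul (hsinh r hr).2 (hsinh r' hr').2 (hsinh r' hr').1 (by positivity)
  have h4 : 1 - Real.cos φ ≤ Real.exp (-R) / 2 := by
    have h5 : φ ^ 2 ≤ Real.exp (-R) := by
      rw [← sq_abs]
      refine (pow_le_pow_left₀ (abs_nonneg _) hφ 2).trans (le_of_eq ?_)
      rw [← Real.exp_nat_mul]
      push_cast
      ring_nf
    linarith [Real.one_sub_sq_div_two_le_cos (x := φ)]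
  have h6 : Real.sinh r * Real.sinh r' * (1 - Real.cos φ) ≤
      Real.exp R / 2 * (Real.exp R / 2) * (Real.exp (-R) / 2) :=
    mul_le_mul h3 h4 (by linarith [Real.cos_le_one φ]) (by positivity)
  have h7 : Real.exp R / 2 * (Real.exp R / 2) * (Real.exp (-R) / 2) = Real.exp R / 8 := by
    rw [Real.exp_neg]
    field_simp
    norm_num
  have h8 : 16 ≤ Real.exp R := by
    have : Real.exp (2 + 2) ≤ Real.exp R := Real.exp_le_exp.2 (by linarith)
    rw [Real.exp_add] at this
    nlinarith [four_le_exp_two]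
  rw [Real.cosh_sub] at h1
  linarith [exp_div_two_le_cosh R]

theorem measureReal_angularMeasure_Icc {a b : ℝ} (hab : a ≤ b)
    (ha : -Real.pi ≤ a) (hb : b ≤ Real.pi) :
    angularMeasure.real (Set.Icc a b) = (b - a) / (2 * Real.pi) := by
  have hpi := Real.pi_pos
  rw [measureReal_def, angularMeasure_eq, Measure.smul_apply,
    Measure.restrict_apply measurableSet_Icc,
    Set.inter_eq_self_of_subset_left (Set.Icc_subset_Icc ha hb), Real.volume_Icc,
    smul_eq_mul, ← ENNReal.ofReal_mul (by positivity), ENNReal.toReal_ofReal]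
  · ring
  · have := sub_nonneg.2 hab
    positivity

/-- The coordinates in the outermost annulus of width one with angle in `[a, b]`. -/
def outerSector (R a b : ℝ) : Set (ℝ × ℝ) := Set.Icc (R - 1) R ×ˢ Set.Icc a b

theorem le_coordLaw_outerSector {α R a b : ℝ} (hα : 1 / 2 < α) (hR : 4 ≤ R) (hab : a ≤ b)
    (ha : -Real.pi ≤ a) (hb : b ≤ Real.pi) :
    α / 4 * Real.exp (-α) * ((b - a) / (2 * Real.pi)) ≤
      (coordLaw α R).real (outerSector R a b) := by
  have := isProbabilityMeasure_radialMeasure (by linarith : 0 < α) (by linarith : 0 < R)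
  rw [coordLaw, outerSector, measureReal_prod_prod, measureReal_angularMeasure_Icc hab ha hb]
  have := sub_nonneg.2 hab
  have := Real.pi_pos
  gcongr
  exact (ENNReal.ofReal_le_iff_le_toReal (measure_ne_top _ _)).1 (le_radialMeasure_Icc hα hR)

/-- A vertex at `p` whose only neighbors are two vertices in a clique has local clustering
coefficient `1`; the events obtained from the different pairs of vertices are disjoint. -/
theorem sum_indicator_exactBox_le_localClustering {R : ℝ} {m : ℕ}
    (v : Fin (m + 1)) (p : ℝ × ℝ) {A : Set (ℝ × ℝ)} (hAN : A ⊆ nbhd R p)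
    (hclique : ∀ q ∈ A, ∀ q' ∈ A, q' ∈ nbhd R q) (y : Fin m → ℝ × ℝ) :
    ∑ T ∈ (Finset.univ : Finset (Fin m)).powersetCard 2,
        (exactBox A (nbhd R p) T).indicator (fun _ => (1 : ℝ)) y ≤
      localClustering (graph R (v.insertNth p y : Fin (m + 1) → ℝ × ℝ)) v := by
  by_cases h : ∃ T ∈ (Finset.univ : Finset (Fin m)).powersetCard 2, y ∈ exactBox A (nbhd R p) T
  · obtain ⟨T, hT, hy⟩ := h
    have hT' := mem_iff_of_mem_exactBox hAN hy
    rw [Finset.sum_eq_single_of_mem T hT, Set.indicator_of_mem hy]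
    · obtain ⟨j, k, hjk, rfl⟩ := Finset.card_eq_two.1 (Finset.mem_powersetCard.1 hT).2
      have hyA : ∀ l ∈ ({j, k} : Finset (Fin m)), y l ∈ A := by
        intro l hl
        have := hy l trivial
        simpa only [hl, if_true] using this
      refine (localClustering_eq_one (a := v.succAbove j) (b := v.succAbove k) ?_ ?_).ge
      · rw [graph_insertNth_adj_succAbove]
        exact ⟨hjk, hclique _ (hyA j (by simp)) _ (hyA k (by simp))⟩
      · intro u
        rcases Fin.eq_self_or_eq_succAbove v u with rfl | ⟨l, rfl⟩
        · simp [(Fin.succAbove_ne u _).symm]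
        · rw [graph_insertNth_adj, hT']
          simp
    · intro T' _ hne
      refine Set.indicator_of_notMem (fun hy' => hne ?_) _
      ext l
      rw [← mem_iff_of_mem_exactBox hAN hy', hT']
  · rw [Finset.sum_eq_zero]
    · exact localClustering_nonneg _ _
    · intro T hT
      exact Set.indicator_of_notMem (fun hy => h ⟨T, hT, hy⟩) _

theorem bddMeas_localClustering_insertNth {R : ℝ} (hR : 0 ≤ R) {m : ℕ} (v : Fin (m + 1)) :
    BddMeas fun z : (ℝ × ℝ) × (Fin m → ℝ × ℝ) =>
      localClustering (graph R (v.insertNth z.1 z.2 : Fin (m + 1) → ℝ × ℝ)) v :=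
  (bddMeas_graph hR fun G => localClustering G v).comp (measurable_insertNth v)

/-- The conditional mean of the local clustering coefficient of a vertex at `p` is at least the
probability that it has exactly two neighbors and that both lie in the clique `A`. -/
theorem le_integral_localClustering_insertNth {α R : ℝ} (hα : 1 / 2 < α) (hR : 4 ≤ R) {m : ℕ}
    (v : Fin (m + 1)) (p : ℝ × ℝ) {A : Set (ℝ × ℝ)} (hA : MeasurableSet A) (hAN : A ⊆ nbhd R p)
    (hclique : ∀ q ∈ A, ∀ q' ∈ A, q' ∈ nbhd R q) :
    (m.choose 2 : ℝ) * ((coordLaw α R).real A ^ 2 *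
        (1 - (coordLaw α R).real (nbhd R p)) ^ (m - 2)) ≤
      ∫ y, localClustering (graph R (v.insertNth p y : Fin (m + 1) → ℝ × ℝ)) v
        ∂(Measure.pi fun _ => coordLaw α R) := by
  have := isProbabilityMeasure_coordLaw hα hR
  have hR0 : 0 ≤ R := by linarith
  have hN := measurableSet_nbhd hR0 p
  have hbm := (bddMeas_localClustering_insertNth hR0 v).comp
    (measurable_prodMk_left (x := p))
  set P := (Finset.univ : Finset (Fin m)).powersetCard 2 with hP
  have hboxm := fun T : Finset (Fin m) => measurableSet_exactBox hA hN T
  calc (m.choose 2 : ℝ) * ((coordLaw α R).real A ^ 2 *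
        (1 - (coordLaw α R).real (nbhd R p)) ^ (m - 2))
      = ∑ T ∈ P, (Measure.pi fun _ => coordLaw α R).real (exactBox A (nbhd R p) T) := by
        have : ∀ T ∈ P, (Measure.pi fun _ => coordLaw α R).real (exactBox A (nbhd R p) T) =
            (coordLaw α R).real A ^ 2 * (1 - (coordLaw α R).real (nbhd R p)) ^ (m - 2) := by
          intro T hT
          rw [measureReal_exactBox _ A hN, (Finset.mem_powersetCard.1 hT).2]
        rw [Finset.sum_congr rfl this, Finset.sum_const, hP, Finset.card_powersetCard,
          Finset.card_univ, Fintype.card_fin, nsmul_eq_mul]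
    _ = ∫ y, ∑ T ∈ P, (exactBox A (nbhd R p) T).indicator (fun _ => (1 : ℝ)) y
          ∂(Measure.pi fun _ => coordLaw α R) := by
        rw [integral_finsetSum _ fun T _ => (bddMeas_indicator (hboxm T)).integrable _]
        refine Finset.sum_congr rfl fun T _ => ?_
        rw [integral_indicator (hboxm T)]
        simp
    _ ≤ _ :=
        integral_mono ((bddMeas_sum _ fun T _ => bddMeas_indicator (hboxm T)).integrable _)
          (hbm.integrable _) (sum_indicator_exactBox_le_localClustering v p hAN hclique)

/-- The lower bound for the expected local clustering coefficient that follows from vertices in the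
outermost annulus. Here `t = e ^ (-R / 2)` is of order `1 / n`. The angle of `v` is taken in
`[-1, 1]` so that the sector around `v` does not wrap around at `π`. -/
theorem le_integral_localClustering {α R t : ℝ} (hα : 1 / 2 < α) (hR : 4 ≤ R) {m : ℕ}
    (ht : t = Real.exp (-(1 / 2) * R)) (hK : 36 * α / (α - 1 / 2) * t ≤ 1)
    (v : Fin (m + 1)) :
    α / 4 * Real.exp (-α) * (2 / (2 * Real.pi)) * ((m.choose 2 : ℝ) *
      ((α / 4 * Real.exp (-α) * (t / (2 * Real.pi))) ^ 2 *
        (1 - 36 * α / (α - 1 / 2) * t) ^ (m - 2))) ≤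
      ∫ x, localClustering (graph R x) v ∂(Measure.pi fun _ => coordLaw α R) := by
  have := isProbabilityMeasure_coordLaw hα hR
  have hR0 : 0 ≤ R := by linarith
  have hpi := Real.pi_gt_three
  have hα' : 0 < α - 1 / 2 := by linarith
  have hα0 : 0 < α := by linarith
  have ht0 : 0 < t := ht ▸ Real.exp_pos _
  have ht1 : t ≤ 1 := by
    rw [ht, Real.exp_le_one_iff]
    linarith
  set c := (m.choose 2 : ℝ) * ((α / 4 * Real.exp (-α) * (t / (2 * Real.pi))) ^ 2 *
    (1 - 36 * α / (α - 1 / 2) * t) ^ (m - 2)) with hc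
  have hc0 : 0 ≤ c := by
    have := pow_nonneg (sub_nonneg.2 hK) (m - 2)
    positivity
  have hSm : MeasurableSet (outerSector R (-1) 1) := measurableSet_Icc.prod measurableSet_Icc
  have hbm := bddMeas_localClustering_insertNth hR0 v
  have hint : Integrable (fun p => ∫ y, localClustering
      (graph R (v.insertNth p y : Fin (m + 1) → ℝ × ℝ)) v
        ∂(Measure.pi fun _ => coordLaw α R)) (coordLaw α R) :=
    (hbm.integrable ((coordLaw α R).prod (Measure.pi fun _ => coordLaw α R))).integral_prod_left
  rw [integral_pi_succAbove _ v (bddMeas_graph hR0 fun G => localClustering G v)]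
  calc α / 4 * Real.exp (-α) * (2 / (2 * Real.pi)) * c
      ≤ (coordLaw α R).real (outerSector R (-1) 1) * c := by
        gcongr
        refine le_trans (le_of_eq ?_)
          (le_coordLaw_outerSector hα hR (by norm_num) (by linarith) (by linarith))
        norm_num
    _ = ∫ p, (outerSector R (-1) 1).indicator (fun _ => c) p ∂coordLaw α R := by
        rw [integral_indicator hSm, setIntegral_const, smul_eq_mul]
    _ ≤ _ := by
        refine integral_mono ((integrable_const c).indicator hSm) hint fun p => ?_
        by_cases hp : p ∈ outerSector R (-1) 1
        · rw [Set.indicator_of_mem hp]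
          obtain ⟨hp1, hp2⟩ := hp
          have hA : MeasurableSet (outerSector R (p.2 - t / 2) (p.2 + t / 2)) :=
            measurableSet_Icc.prod measurableSet_Icc
          refine le_trans ?_ (le_integral_localClustering_insertNth hα hR v p hA ?_ ?_)
          · have hp1' : p.1 ∈ Set.Icc 0 R := ⟨by linarith [hp1.1], hp1.2⟩
            have hp2' : p.2 ∈ Set.Icc (-Real.pi) Real.pi :=
              ⟨by linarith [hp2.1], by linarith [hp2.2]⟩
            have hq := coordLaw_nbhd_le hα hR hp1' hp2'
            -- `√e ≤ 2` accounts for the width of the annulus.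
            have he : Real.exp (-(1 / 2) * p.1) ≤ 2 * t := by
              have h1 : Real.exp (-(1 / 2) * p.1) ≤ Real.exp (1 / 2) * t := by
                rw [ht, ← Real.exp_add]
                exact Real.exp_le_exp.2 (by linarith [hp1.1])
              have h2 : Real.exp (1 / 2) ≤ 2 := by
                refine le_of_sq_le_sq ?_ (by norm_num)
                rw [← Real.exp_nat_mul]
                norm_num
                exact Real.exp_one_lt_d9.le.trans (by norm_num)
              nlinarith
            have hq' : (coordLaw α R).real (nbhd R p) ≤ 36 * α / (α - 1 / 2) * t := by
              refine hq.trans ((mul_le_mul_of_nonneg_left he (by positivity)).trans (le_of_eq ?_))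
              ring
            rw [hc]
            have hsec := le_coordLaw_outerSector (a := p.2 - t / 2) (b := p.2 + t / 2) hα hR
              (by linarith) (by linarith [hp2.1]) (by linarith [hp2.2])
            rw [show p.2 + t / 2 - (p.2 - t / 2) = t by ring] at hsec
            have := sub_nonneg.2 hK
            gcongr
          · intro q hq
            refine hypDist_le_of_close hR hp1 hq.1 ?_
            rw [← ht, abs_le]
            constructor <;> linarith [hq.2.1, hq.2.2]
          · intro q hq q' hq'
            refine hypDist_le_of_close hR hq.1 hq'.1 ?_
            rw [← ht, abs_le]
            constructor <;> linarith [hq.2.1, hq.2.2, hq'.2.1, hq'.2.2]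
        · rw [Set.indicator_of_notMem hp]
          exact integral_nonneg fun y => localClustering_nonneg _ _

/-! ### Asymptotics -/

theorem tendsto_radius (C : ℝ) : Tendsto (radius C) atTop atTop :=
  tendsto_atTop_add_const_right _ _
    ((Real.tendsto_log_atTop.comp tendsto_natCast_atTop_atTop).const_mul_atTop two_pos)

theorem exp_neg_mul_radius (C s : ℝ) {n : ℕ} (hn : 0 < n) :
    Real.exp (-s * radius C n) = Real.exp (-s * C) * (n : ℝ) ^ (-(2 * s)) := by
  rw [Real.rpow_def_of_pos (by exact_mod_cast hn), ← Real.exp_add, radius]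
  ring_nf

theorem exp_neg_half_mul_radius (C : ℝ) {n : ℕ} (hn : 0 < n) :
    Real.exp (-(1 / 2) * radius C n) = Real.exp (-(1 / 2) * C) * (n : ℝ)⁻¹ := by
  rw [exp_neg_mul_radius C _ hn, mul_one_div_cancel two_ne_zero, Real.rpow_neg_one]

/-- The variance of `c̄` tends to zero. The bound `V` is positive, so that one can divide by it in
Chebyshev's inequality. -/
theorem exists_variance_bound {α : ℝ} (C : ℝ) (hα : 1 / 2 < α) :
    ∃ V : ℕ → ℝ, Tendsto V atTop (𝓝 0) ∧ ∀ᶠ n in atTop, 0 < V n ∧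
      ∫ x, (clustering C n x - expectedClustering α C n) ^ 2 ∂(coordMeasure α C n) ≤ V n := by
  obtain ⟨s, hs, hs'⟩ := exists_between (show 1 / 2 < min 1 α from lt_min (by norm_num) hα)
  have hsα : s < α := hs'.trans_le (min_le_right _ _)
  have hs1 : s < 1 := hs'.trans_le (min_le_left _ _)
  have hα' : 0 < α - 1 / 2 := by linarith
  have hαs : 0 < α - s := by linarith
  have hα0 : 0 < α := by linarith
  set K₁ := 18 * α / (α - 1 / 2) * (2 * α / (α - 1 / 2)) * Real.exp (-(1 / 2) * C) with hK₁
  set K₂ := (18 * α / (α - 1 / 2)) ^ 2 * (2 * α / (α - s)) * Real.exp (-s * C) with hK₂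
  refine ⟨fun n => (2 + 2 * K₁) * (n : ℝ)⁻¹ + 2 * K₂ * (n : ℝ) ^ (-(2 * s - 1)), ?_, ?_⟩
  · have h1 : Tendsto (fun n : ℕ => (n : ℝ)⁻¹) atTop (𝓝 0) :=
      tendsto_inv_atTop_zero.comp tendsto_natCast_atTop_atTop
    have h2 : Tendsto (fun n : ℕ => (n : ℝ) ^ (-(2 * s - 1))) atTop (𝓝 0) :=
      (tendsto_rpow_neg_atTop (by linarith)).comp tendsto_natCast_atTop_atTop
    simpa using (h1.const_mul (2 + 2 * K₁)).add (h2.const_mul (2 * K₂))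
  · filter_upwards [eventually_gt_atTop 0, (tendsto_radius C).eventually_ge_atTop 4] with n hn hR
    have hn' : (0 : ℝ) < n := by exact_mod_cast hn
    refine ⟨by positivity, ?_⟩
    refine (variance_clustering_le hα hsα (by linarith) hs1.le hR).trans (le_of_eq ?_)
    rw [exp_neg_half_mul_radius C hn, exp_neg_mul_radius C s hn,
      show -(2 * s - 1) = -(2 * s) + 1 by ring, Real.rpow_add_one hn'.ne', hK₁, hK₂]
    clear hK₁ hK₂ K₁ K₂
    generalize α - 1 / 2 = β at hα' ⊢
    generalize α - s = γ at hαs ⊢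
    field_simp
    ring

theorem exp_neg_two_mul_le {x : ℝ} (hx0 : 0 ≤ x) (hx : x ≤ 1 / 2) :
    Real.exp (-(2 * x)) ≤ 1 - x := by
  have h1 : 1 + 2 * x ≤ Real.exp (2 * x) := by linarith [Real.add_one_le_exp (2 * x)]
  rw [Real.exp_neg, inv_le_iff_one_le_mul₀ (Real.exp_pos _)]
  nlinarith

theorem exists_le_expectedClustering {α : ℝ} (C : ℝ) (hα : 1 / 2 < α) :
    ∃ c, 0 < c ∧ ∀ᶠ n in atTop, c ≤ expectedClustering α C n := by
  have hα' : 0 < α - 1 / 2 := by linarith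
  have hα0 : 0 < α := by linarith
  have hpi := Real.pi_pos
  set K := 36 * α / (α - 1 / 2) with hK
  have hK0 : 0 < K := by positivity
  set D := Real.exp (-(1 / 2) * C) with hD
  have hD0 : 0 < D := Real.exp_pos _
  set a := α / 4 * Real.exp (-α) with ha
  have ha0 : 0 < a := by positivity
  refine ⟨a * (2 / (2 * Real.pi)) * (D ^ 2 / 9 * (a / (2 * Real.pi)) ^ 2 *
    Real.exp (-(2 * K * D))), by positivity, ?_⟩
  have hlim : Tendsto (fun n : ℕ => K * (D * (n : ℝ)⁻¹)) atTop (𝓝 0) := by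
    simpa using ((tendsto_inv_atTop_zero.comp tendsto_natCast_atTop_atTop).const_mul D).const_mul K
  filter_upwards [eventually_ge_atTop 3, (tendsto_radius C).eventually_ge_atTop 4,
    hlim.eventually_le_const (by norm_num : (0 : ℝ) < 1 / 2)] with n hn hR hKt
  obtain ⟨m, rfl⟩ : ∃ m, n = m + 1 := ⟨n - 1, by omega⟩
  have := isProbabilityMeasure_coordLaw hα hR
  have ht := exp_neg_half_mul_radius C (show 0 < m + 1 by omega)
  rw [← hD] at ht
  set t := D * ((m + 1 : ℕ) : ℝ)⁻¹ with htdef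
  have hm : (2 : ℝ) ≤ m := by exact_mod_cast (show 2 ≤ m by omega)
  have ht0 : 0 < t := by positivity
  have hDt : D = t * (m + 1) := by
    rw [htdef]
    push_cast
    field_simp
  have hv : ∀ v, a * (2 / (2 * Real.pi)) * (D ^ 2 / 9 * (a / (2 * Real.pi)) ^ 2 *
      Real.exp (-(2 * K * D))) ≤
      ∫ x, localClustering (graph (radius C (m + 1)) x) v ∂(coordMeasure α C (m + 1)) := by
    intro v
    refine le_trans ?_ (le_integral_localClustering hα hR ht.symm (by linarith) v)
    rw [← ha, ← hK]
    refine mul_le_mul_of_nonneg_left ?_ (by positivity)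
    have hpow : Real.exp (-(2 * K * D)) ≤ (1 - K * t) ^ (m - 2) := by
      calc Real.exp (-(2 * K * D)) ≤ Real.exp (-(2 * (K * t))) ^ (m - 2) := by
            rw [← Real.exp_nat_mul]
            refine Real.exp_le_exp.2 ?_
            rw [hDt, Nat.cast_sub (show 2 ≤ m by omega)]
            push_cast
            nlinarith [mul_pos hK0 ht0]
        _ ≤ _ := pow_le_pow_left₀ (Real.exp_nonneg _)
            (exp_neg_two_mul_le (by positivity) hKt) _
    have hchoose : D ^ 2 / 9 ≤ (m.choose 2 : ℝ) * t ^ 2 := by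
      rw [Nat.cast_choose_two, hDt, mul_pow]
      have : ((m : ℝ) + 1) ^ 2 / 9 ≤ m * (m - 1) / 2 := by nlinarith
      nlinarith [sq_nonneg t]
    calc D ^ 2 / 9 * (a / (2 * Real.pi)) ^ 2 * Real.exp (-(2 * K * D))
        ≤ (m.choose 2 : ℝ) * t ^ 2 * (a / (2 * Real.pi)) ^ 2 * (1 - K * t) ^ (m - 2) := by
          gcongr
      _ = _ := by ring
  have hE : expectedClustering α C (m + 1) = 1 / ((m + 1 : ℕ) : ℝ) *
      ∑ v, ∫ x, localClustering (graph (radius C (m + 1)) x) v ∂(coordMeasure α C (m + 1)) := by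
    unfold expectedClustering clustering globalClustering
    rw [integral_const_mul, Fintype.card_fin, integral_finsetSum]
    exact fun v _ => (bddMeas_graph (by linarith) fun G => localClustering G v).integrable
      (Measure.pi fun _ => coordLaw α (radius C (m + 1)))
  rw [hE, one_div_mul_eq_div, le_div_iff₀ (by positivity)]
  refine le_trans (le_of_eq ?_) (Finset.sum_le_sum fun v _ => hv v)
  simp [mul_comm]

/-- Chebyshev's inequality for the relative deviation of the clustering coefficient. The relative
error `V ^ (1 / 4)` and the exceptional probability `V ^ (1 / 2) / c ^ 2` both vanish with `V`. -/
theorem one_sub_le_measureReal_abs_sub_le {α C c V : ℝ} (hα : 1 / 2 < α) {n : ℕ}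
    (hR : 4 ≤ radius C n) (hc : 0 < c) (hE : c ≤ expectedClustering α C n) (hV : 0 < V)
    (hvar : ∫ x, (clustering C n x - expectedClustering α C n) ^ 2 ∂(coordMeasure α C n) ≤ V) :
    1 - Real.sqrt V / c ^ 2 ≤ (coordMeasure α C n).real
      {x | |clustering C n x - expectedClustering α C n| ≤
        Real.sqrt (Real.sqrt V) * expectedClustering α C n} := by
  have := isProbabilityMeasure_coordMeasure hα hR
  set E := expectedClustering α C n with hEdef
  set S := {x | |clustering C n x - E| ≤ Real.sqrt (Real.sqrt V) * E} with hS
  have hsV : 0 < Real.sqrt V := Real.sqrt_pos.2 hV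
  have hmarkov := mul_meas_ge_le_integral_of_nonneg (μ := coordMeasure α C n)
    (ae_of_all _ fun x => sq_nonneg (clustering C n x - E))
    (((bddMeas_clustering (by linarith)).sub (.const E)).sq.integrable _) (Real.sqrt V * c ^ 2)
  have hcompl : (coordMeasure α C n).real Sᶜ ≤
      (coordMeasure α C n).real {x | Real.sqrt V * c ^ 2 ≤ (clustering C n x - E) ^ 2} := by
    refine measureReal_mono fun x hx => ?_
    have hx' : Real.sqrt (Real.sqrt V) * E < |clustering C n x - E| := not_le.1 hx
    have h1 : Real.sqrt V * c ^ 2 = (Real.sqrt (Real.sqrt V) * c) ^ 2 := by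
      rw [mul_pow, Real.sq_sqrt hsV.le]
    simp only [Set.mem_ofPred_eq]
    rw [h1, ← sq_abs (clustering C n x - E)]
    exact pow_le_pow_left₀ (by positivity)
      ((mul_le_mul_of_nonneg_left hE (Real.sqrt_nonneg _)).trans hx'.le) 2
  have hle : (coordMeasure α C n).real Sᶜ ≤ Real.sqrt V / c ^ 2 := by
    refine hcompl.trans ?_
    rw [le_div_iff₀ (by positivity)]
    refine le_of_mul_le_mul_left ?_ hsV
    calc Real.sqrt V * ((coordMeasure α C n).real
          {x | Real.sqrt V * c ^ 2 ≤ (clustering C n x - E) ^ 2} * c ^ 2)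
        = Real.sqrt V * c ^ 2 * (coordMeasure α C n).real
          {x | Real.sqrt V * c ^ 2 ≤ (clustering C n x - E) ^ 2} := by ring
      _ ≤ V := hmarkov.trans hvar
      _ = Real.sqrt V * Real.sqrt V := (Real.mul_self_sqrt hV.le).symm
  have huniv : (1 : ℝ) ≤ (coordMeasure α C n).real S + (coordMeasure α C n).real Sᶜ := by
    have := measureReal_union_le (μ := coordMeasure α C n) S Sᶜ
    rwa [Set.union_compl_self, probReal_univ] at this
  linarith

theorem measureReal_coordMeasure_le_one {α C : ℝ} (hα : 1 / 2 < α) {n : ℕ}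
    (hR : 4 ≤ radius C n) (S : Set (Fin n → ℝ × ℝ)) : (coordMeasure α C n).real S ≤ 1 := by
  have := isProbabilityMeasure_coordMeasure hα hR
  exact measureReal_le_one

theorem expectedClustering_le_one {α C : ℝ} (hα : 1 / 2 < α) {n : ℕ}
    (hR : 4 ≤ radius C n) : expectedClustering α C n ≤ 1 := by
  have := isProbabilityMeasure_coordMeasure hα hR
  refine (integral_mono ((bddMeas_clustering (by linarith)).integrable _) (integrable_const 1)
    fun x => globalClustering_le_one _).trans (le_of_eq ?_)
  simp

end HyperbolicGraph
end

theorem theorem1 (α C : ℝ) (hα : 1 / 2 < α) :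
    (HyperbolicGraph.expectedClustering α C =Θ[atTop] fun _ : ℕ => (1 : ℝ)) ∧
    (∃ ε : ℕ → ℝ, Tendsto ε atTop (𝓝 0) ∧
      Tendsto (fun n : ℕ => (HyperbolicGraph.coordMeasure α C n).real
        {x | |HyperbolicGraph.clustering C n x - HyperbolicGraph.expectedClustering α C n| ≤
          ε n * HyperbolicGraph.expectedClustering α C n}) atTop (𝓝 1)) ∧
    (∃ c : ℝ, 0 < c ∧
      Tendsto (fun n : ℕ => (HyperbolicGraph.coordMeasure α C n).real
        {x | c ≤ HyperbolicGraph.clustering C n x}) atTop (𝓝 1)) := by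
  obtain ⟨c, hc, hE⟩ := HyperbolicGraph.exists_le_expectedClustering C hα
  obtain ⟨V, hV, hVar⟩ := HyperbolicGraph.exists_variance_bound C hα
  have hR := (HyperbolicGraph.tendsto_radius C).eventually_ge_atTop 4
  have hsV : Tendsto (fun n => Real.sqrt (V n)) atTop (𝓝 0) := by
    simpa using hV.sqrt
  have hε : Tendsto (fun n => Real.sqrt (Real.sqrt (V n))) atTop (𝓝 0) := by
    simpa using hsV.sqrt
  have hlow : Tendsto (fun n => 1 - Real.sqrt (V n) / c ^ 2) atTop (𝓝 1) := by
    simpa using (hsV.div_const (c ^ 2)).const_sub 1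
  have hconc : ∀ᶠ n in atTop, 1 - Real.sqrt (V n) / c ^ 2 ≤
      (HyperbolicGraph.coordMeasure α C n).real
        {x | |HyperbolicGraph.clustering C n x - HyperbolicGraph.expectedClustering α C n| ≤
          Real.sqrt (Real.sqrt (V n)) * HyperbolicGraph.expectedClustering α C n} := by
    filter_upwards [hE, hVar, hR] with n h1 h2 h3
    exact HyperbolicGraph.one_sub_le_measureReal_abs_sub_le hα h3 hc h1 h2.1 h2.2
  refine ⟨⟨?_, ?_⟩, ⟨_, hε, ?_⟩, c / 2, by positivity, ?_⟩
  · refine IsBigO.of_bound 1 ?_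
    filter_upwards [hE, hR] with n h1 h2
    rw [Real.norm_of_nonneg (hc.le.trans h1), norm_one, mul_one]
    exact HyperbolicGraph.expectedClustering_le_one hα h2
  · refine IsBigO.of_bound c⁻¹ ?_
    filter_upwards [hE] with n h1
    rw [Real.norm_of_nonneg (hc.le.trans h1), norm_one, inv_mul_eq_div, le_div_iff₀ hc, one_mul]
    exact h1
  · refine tendsto_of_tendsto_of_tendsto_of_le_of_le' hlow tendsto_const_nhds hconc ?_
    filter_upwards [hR] with n h
    exact HyperbolicGraph.measureReal_coordMeasure_le_one hα h _
  · refine tendsto_of_tendsto_of_tendsto_of_le_of_le' hlow tendsto_const_nhds ?_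
      (hR.mono fun n h => HyperbolicGraph.measureReal_coordMeasure_le_one hα h _)
    filter_upwards [hconc, hE, hR, hε.eventually_le_const (by norm_num : (0 : ℝ) < 1 / 2)]
      with n h1 h2 h3 h4
    have := HyperbolicGraph.isProbabilityMeasure_coordMeasure hα h3
    refine h1.trans (measureReal_mono fun x hx => ?_)
    simp only [Set.mem_ofPred_eq] at hx ⊢
    nlinarith [(abs_le.1 hx).1]
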